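/- Let $\mathbb{K}$ be a field of characteristic $0$, let $n$ be a positive integer, and let $S = \mathbb{K}[x_1,\dots,x_n]$. Let $(S_+^{\mathfrak{S}_n}) \subseteq S$ be the ideal generated by the symmetric polynomials with vanishing constant term. For $J \subseteq [n] = \{1,\dots,n\}$ put $$ f_J = \prod_{j \in J} \Bigl( x_j \prod_{i=j+1}^{n} (x_j - x_i) \Bigr), \qquad (S_+^{\mathfrak{S}_n}) : f_J = \{ g \in S : f_J\, g \in (S_+^{\mathfrak{S}_n}) \}. $$ Let $\mathcal{A}_J$ be the hyperplane arrangement in $\mathbb{K}^n$ consisting of the hyperplanes $x_j = x_i$ for $j \notin J$, $i > j$, and $x_j = 0$ for $j \notin J$. For a (finite, linear) hyperplane arrangement $\mathcal{A}$ in $\mathbb{K}^n$ let $Q(\mathcal{A})$ be the product of linear forms with kernels the hyperplanes $H \in \mathcal{A}$, let $\mathrm{Der}(\mathcal{A})$ be the $S$-module of all $\mathbb{K}$-derivations $\rho$ of $S$ such that $Q(\mathcal{A})$ divides $\rho(Q(\mathcal{A}))$, and let $\mathfrak{i} \colon \mathrm{Der}(S) \to S$ be the $S$-linear map with $\mathfrak{i}(\partial_k)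 = 1$ for all $k$, where $\partial_k = \partial/\partial x_k$. The Solomon--Terao ideal of $\mathcal{A}$ is $\mathfrak{i}_{\mathcal{A}} = \mathfrak{i}(\mathrm{Der}(\mathcal{A})) \subseteq S$, and $\mathcal{ST}(\mathcal{A},\mathfrak{i}) = S/\mathfrak{i}_{\mathcal{A}}$. For $1 \le i \le n$ define the derivation $$ \rho^J_i = \begin{cases} \displaystyle\sum_{k=i}^{n} \Bigl( \prod_{j \notin J,\ j < i} (x_j - x_k) \Bigr) x_k\, \partial_k & i \notin J, \\[2mm] \displaystyle\prod_{j \notin J,\ j < i} (x_j - x_i)\, \partial_i & i \in J, \end{cases} $$ and $$ g_{J,i} = \begin{cases} \displaystyle\sum_{k=i}^{n} \Bigl( \prod_{j \notin J,\ j < i} (x_j - x_k) \Bigr) x_k & i \notin J, \\[2mm] \displaystyle\prod_{j \notin J,\ j < i} (x_j - x_i) & i \in J. \end{cases} $$ Then, for every $J \subseteq [n]$: 1. $\mathfrak{i}_{\mathcal{A}_J} = (S_+^{\mathfrak{S}_n}) : f_J$, that is, $\mathcal{ST}(\mathcal{A}_J,\mathfrak{i}) = S/((S_+^{\mathfrak{S}_n})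 : f_J)$; 2. $g_{J,i} = \mathfrak{i}(\rho^J_i)$ for $1 \le i \le n$; 3. if $1 \in J$, then $(S_+^{\mathfrak{S}_n}) : f_J = S$; 4. if $1 \notin J$, then $g_{J,1},\dots,g_{J,n}$ is a regular sequence in $S$ (that is, $(g_{J,1},\dots,g_{J,n}) \ne S$ and multiplication by $g_{J,i}$ is injective on $S/(g_{J,1},\dots,g_{J,i-1})$ for each $i$), and it generates the ideal $(S_+^{\mathfrak{S}_n}) : f_J$. -/

import Mathlib

namespace SolomonTerao

open MvPolynomial

noncomputable section

/-- A hyperplane arrangement in `K ^ n`: a finite set of linear subspaces of codimension `1`. -/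
structure HyperplaneArrangement (K : Type*) [Field K] (n : ℕ) where
  /-- The set of hyperplanes. -/
  hyperplanes : Set (Submodule K (Fin n → K))
  finite : hyperplanes.Finite
  codim_one : ∀ H ∈ hyperplanes, Module.finrank K ((Fin n → K) ⧸ H) = 1

section

variable {K : Type*} [Field K] {n : ℕ}

theorem exists_ker_eq_of_codim_one (H : Submodule K (Fin n → K))
    (hH : Module.finrank K ((Fin n → K) ⧸ H) = 1) :
    ∃ α : Module.Dual K (Fin n → K), LinearMap.ker α = H := by
  have e : ((Fin n → K) ⧸ H) ≃ₗ[K] K :=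
    LinearEquiv.ofFinrankEq _ _ (by rw [hH, Module.finrank_self])
  refine ⟨e.toLinearMap ∘ₗ H.mkQ, ?_⟩
  rw [LinearMap.ker_comp, LinearEquiv.ker, Submodule.comap_bot, Submodule.ker_mkQ]

theorem finrank_quotient_ker (α : Module.Dual K (Fin n → K)) (hα : α ≠ 0) :
    Module.finrank K ((Fin n → K) ⧸ LinearMap.ker α) = 1 := by
  have hs : Function.Surjective α := LinearMap.surjective hα
  rw [(LinearMap.quotKerEquivOfSurjective α hs).finrank_eq, Module.finrank_self]

open Classical in
/-- A linear form `α_H` with kernel `H` (unique up to a nonzero scalar if `H` is a hyperplane). -/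
def formOf (H : Submodule K (Fin n → K)) : Module.Dual K (Fin n → K) :=
  if h : ∃ α : Module.Dual K (Fin n → K), LinearMap.ker α = H then h.choose else 0

theorem ker_formOf (H : Submodule K (Fin n → K))
    (hH : Module.finrank K ((Fin n → K) ⧸ H) = 1) : LinearMap.ker (formOf H) = H := by
  have h := exists_ker_eq_of_codim_one H hH
  rw [formOf, dif_pos h]
  exact h.choose_spec

/-- A linear form on `K ^ n`, regarded as a homogeneous linear polynomial
`∑ i, α(e_i) x_i` in `S = K[x_1, …, x_n]`. -/
def formPoly (α : Module.Dual K (Fin n → K)) : MvPolynomial (Fin n) K :=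
  ∑ i, C (α (Pi.single i 1)) * X i

namespace HyperplaneArrangement

/-- The defining polynomial `Q(A) = ∏_{H ∈ A} α_H`. -/
def definingPoly (A : HyperplaneArrangement K n) : MvPolynomial (Fin n) K :=
  ∏ H ∈ A.finite.toFinset, formPoly (formOf H)

/-- The derivation module `Der(A)`: all `ρ ∈ Der(S)` such that `Q(A)` divides `ρ(Q(A))`. -/
def der (A : HyperplaneArrangement K n) :
    Submodule (MvPolynomial (Fin n) K)
      (Derivation K (MvPolynomial (Fin n) K) (MvPolynomial (Fin n) K)) where
  carrier := {ρ | A.definingPoly ∣ ρ A.definingPoly}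
  zero_mem' := by simp
  add_mem' := by
    intro ρ σ hρ hσ
    exact dvd_add hρ hσ
  smul_mem' := by
    intro f ρ hρ
    exact Dvd.dvd.mul_left hρ f

/-- The Solomon–Terao ideal `𝔠_A = 𝔠(Der(A))` of an `S`-module map `𝔠 : Der(S) → S`;
the Solomon–Terao algebra is the quotient of `S` by it. -/
def solomonTeraoIdeal (A : HyperplaneArrangement K n)
    (c : Derivation K (MvPolynomial (Fin n) K) (MvPolynomial (Fin n) K)
      →ₗ[MvPolynomial (Fin n) K] MvPolynomial (Fin n) K) :
    Ideal (MvPolynomial (Fin n) K) :=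
  A.der.map c

end HyperplaneArrangement

end

section

variable (K : Type*) [Field K] (n : ℕ)

/-- The `S`-module map `𝔦 : Der(S) → S` with `∂_i ↦ 1` for all `i`; a derivation
`ρ` is `∑ i, ρ(x_i) ∂_i`, so it is sent to `∑ i, ρ(x_i)`. -/
def iMap : Derivation K (MvPolynomial (Fin n) K) (MvPolynomial (Fin n) K)
    →ₗ[MvPolynomial (Fin n) K] MvPolynomial (Fin n) K where
  toFun ρ := ∑ i, ρ (X i)
  map_add' ρ σ := by simp [Finset.sum_add_distrib]
  map_smul' f ρ := by simp [Finset.mul_sum]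

theorem iMap_pderiv (i : Fin n) : iMap K n (pderiv i) = 1 := by
  classical
  simp [iMap, pderiv_X, Pi.single_apply]

/-- The coinvariant ideal `(S_+^{𝔖_n})`: generated by the symmetric polynomials
with vanishing constant term. -/
def coinvariantIdeal : Ideal (MvPolynomial (Fin n) K) :=
  Ideal.span {p | p.IsSymmetric ∧ constantCoeff p = 0}

variable {n} (J : Finset (Fin n))

/-- `f_J = ∏_{j ∈ J} x_j ∏_{i > j} (x_j - x_i)`. -/
def fPoly : MvPolynomial (Fin n) K :=
  ∏ j ∈ J, (X j * ∏ i ∈ Finset.univ.filter (fun i => j < i), (X j - X i))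

/-- The colon ideal `(S_+^{𝔖_n}) : f_J`. -/
def colonIdeal : Ideal (MvPolynomial (Fin n) K) :=
  (coinvariantIdeal K n).colon {fPoly K J}

theorem mem_colonIdeal (p : MvPolynomial (Fin n) K) :
    p ∈ colonIdeal K J ↔ fPoly K J * p ∈ coinvariantIdeal K n := by
  rw [colonIdeal, Submodule.mem_colon_singleton, smul_eq_mul, mul_comm]

/-- The subspace `x_j = 0` of `K ^ n`. -/
def coordHyperplane (j : Fin n) : Submodule K (Fin n → K) :=
  LinearMap.ker (LinearMap.proj j : (Fin n → K) →ₗ[K] K)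

/-- The subspace `x_j = x_i` of `K ^ n`. -/
def diagHyperplane (j i : Fin n) : Submodule K (Fin n → K) :=
  LinearMap.ker ((LinearMap.proj j : (Fin n → K) →ₗ[K] K) - LinearMap.proj i)

/-- The arrangement `A_J`, with the hyperplanes `x_j = x_i` for `j ∉ J`, `i > j` and the
hyperplanes `x_j = 0` for `j ∉ J`. -/
def arrangementJ : HyperplaneArrangement K n where
  hyperplanes := {H | ∃ j i, j ∉ J ∧ j < i ∧ H = diagHyperplane K j i} ∪
    {H | ∃ j, j ∉ J ∧ H = coordHyperplane K j}
  finite := by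
    refine Set.Finite.union ?_ ?_
    · refine (Set.finite_range (fun q : Fin n × Fin n => diagHyperplane K q.1 q.2)).subset ?_
      rintro H ⟨j, i, -, -, rfl⟩
      exact ⟨(j, i), rfl⟩
    · refine (Set.finite_range (fun j : Fin n => coordHyperplane K j)).subset ?_
      rintro H ⟨j, -, rfl⟩
      exact ⟨j, rfl⟩
  codim_one := by
    rintro H (⟨j, i, -, hji, rfl⟩ | ⟨j, -, rfl⟩)
    · refine finrank_quotient_ker _ fun h => ?_
      have h1 := LinearMap.congr_fun h (Pi.single j 1)
      simp [Pi.single_eq_of_ne hji.ne'] at h1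
    · refine finrank_quotient_ker _ fun h => ?_
      have h1 := LinearMap.congr_fun h (Pi.single j 1)
      simp at h1

/-- The derivation `ρ^J_i`. -/
def rho (i : Fin n) : Derivation K (MvPolynomial (Fin n) K) (MvPolynomial (Fin n) K) :=
  if i ∉ J then
    ∑ k ∈ Finset.univ.filter (fun k => i ≤ k),
      ((∏ j ∈ Finset.univ.filter (fun j => j ∉ J ∧ j < i),
        (X j - X k : MvPolynomial (Fin n) K)) * X k) • pderiv k
  else
    (∏ j ∈ Finset.univ.filter (fun j => j ∉ J ∧ j < i),
      (X j - X i : MvPolynomial (Fin n) K)) • pderiv i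

/-- The polynomial `g_{J,i}`, written out. -/
def gPoly (i : Fin n) : MvPolynomial (Fin n) K :=
  if i ∉ J then
    ∑ k ∈ Finset.univ.filter (fun k => i ≤ k),
      (∏ j ∈ Finset.univ.filter (fun j => j ∉ J ∧ j < i), (X j - X k)) * X k
  else
    ∏ j ∈ Finset.univ.filter (fun j => j ∉ J ∧ j < i), (X j - X i)

end

end

end SolomonTerao

/-! Both ideals are compared with the ideal generated by the `gPoly K J i`.

On the arrangement side, `mem_der_arrangementJ_iff` turns membership in `Der(A_J)` into one
divisibility per hyperplane. The `rho K J i` are triangular: `rho K J i` kills `x_k` for `k < i`,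
and by `rho_self_dvd` its value at `x_i` divides that of every logarithmic derivation with the same
vanishing. Elimination shows that they generate, and `iMap` carries them to the `gPoly K J i`.

On the colon side, induct on `J`. For `J = ∅`, expansion and Newton's identities make the generators
a triangular change of `e_1, …, e_n`, with nonzero diagonal in characteristic `0`; these form a
regular sequence and generate the coinvariant ideal. When `m` joins `J`, the generators below `m`
stay the same, and for `i ≥ m` the old one is `linearFactor K m i` times the new one modulo later
new ones (`gPoly_sub_mem_span`). These factors multiply to `f_{ {m} }`. Exchanging generators from
the last index down to `m` removes one factor at a time: if `ℓ b` is regular modulo `I`, then so is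
`b`, and `(I + (ℓ b)) : ℓ = I + (b)`.

Such exchanges need regular sequences to be permutable, which holds for homogeneous elements of
positive degree. This is where the first index must lie outside `J`; if it lies in `J`, one
generator is `1` and both ideals are the whole ring. -/

namespace SolomonTerao

open MvPolynomial RingTheory.Sequence

/-! ### Nonzerodivisors modulo an ideal -/

/-- `b` is a nonzerodivisor modulo the ideal `I`. -/
def RegularMod {R : Type*} [CommRing R] (I : Ideal R) (b : R) : Prop :=
  ∀ y, b * y ∈ I → y ∈ I

section RegularMod

variable {R : Type*} [CommRing R] {I : Ideal R}

theorem isSMulRegular_quotient_iff (b : R) :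
    IsSMulRegular (R ⧸ (I • ⊤ : Submodule R R)) b ↔ RegularMod I b := by
  have hI : (I • ⊤ : Submodule R R) = I := by simp
  rw [hI, isSMulRegular_iff_right_eq_zero_of_smul]
  constructor
  · intro h y hy
    have := h (Ideal.Quotient.mk I y) (by
      rw [← Ideal.Quotient.mk_eq_mk, ← Submodule.Quotient.mk_smul, Submodule.Quotient.mk_eq_zero]
      exact hy)
    exact Ideal.Quotient.eq_zero_iff_mem.mp this
  · intro h y
    obtain ⟨y, rfl⟩ := Submodule.Quotient.mk_surjective _ y
    rw [← Submodule.Quotient.mk_smul, Submodule.Quotient.mk_eq_zero, Submodule.Quotient.mk_eq_zero]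
    exact h y

theorem RegularMod.mul {a b : R} (ha : RegularMod I a) (hb : RegularMod I b) :
    RegularMod I (a * b) := fun y hy => hb y (ha _ (by rwa [← mul_assoc]))

theorem RegularMod.prod {ι : Type*} (s : Finset ι) (f : ι → R)
    (h : ∀ i ∈ s, RegularMod I (f i)) : RegularMod I (∏ i ∈ s, f i) := by
  classical
  induction s using Finset.induction_on with
  | empty => intro y hy; simpa using hy
  | insert a s ha ih =>
    rw [Finset.prod_insert ha]
    exact (h a (by simp)).mul (ih fun i hi => h i (by simp [hi]))

theorem RegularMod.of_mul_right {a b : R} (h : RegularMod I (a * b)) : RegularMod I b :=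
  fun y hy => h y (by rw [mul_assoc]; exact I.mul_mem_left _ hy)

theorem RegularMod.of_mul_left {a b : R} (h : RegularMod I (a * b)) : RegularMod I a :=
  RegularMod.of_mul_right (a := b) (by rwa [mul_comm])

theorem RegularMod.congr {a b : R} (h : RegularMod I a) (hab : b - a ∈ I) : RegularMod I b := by
  intro y hy
  refine h y ?_
  have : a * y = b * y - (b - a) * y := by ring
  rw [this]
  exact I.sub_mem hy (I.mul_mem_right _ hab)

theorem RegularMod.map {R' : Type*} [CommRing R'] (e : R ≃+* R') {b : R} (h : RegularMod I b) :
    RegularMod (I.map e) (e b) := by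
  intro y hy
  rw [Ideal.mem_map_of_equiv] at hy ⊢
  obtain ⟨z, hz, hzy⟩ := hy
  refine ⟨e.symm y, h _ ?_, by simp⟩
  have : b * e.symm y = z := e.injective (by simp [hzy])
  rwa [this]

end RegularMod

/-! ### Permutability of homogeneous regular sequences -/

section Homogeneous

variable {K : Type*} [Field K] {σ : Type*}

/-- Homogeneous of positive degree. -/
def PosHomogeneous (p : MvPolynomial σ K) : Prop := ∃ d, 0 < d ∧ p.IsHomogeneous d

theorem PosHomogeneous.constantCoeff {p : MvPolynomial σ K} (h : PosHomogeneous p) :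
    MvPolynomial.constantCoeff p = 0 := by
  obtain ⟨d, hd, hp⟩ := h
  rw [constantCoeff_eq]
  exact hp.coeff_eq_zero (by simpa using hd.ne)

theorem posHomogeneous_X (i : σ) : PosHomogeneous (X i : MvPolynomial σ K) :=
  ⟨1, one_pos, isHomogeneous_X _ _⟩

theorem homogeneousComponent_mem_span {s : Set (MvPolynomial σ K)}
    (hs : ∀ p ∈ s, PosHomogeneous p) {p : MvPolynomial σ K} (hp : p ∈ Ideal.span s) (d : ℕ) :
    homogeneousComponent d p ∈ Ideal.span s := by
  let := MvPolynomial.gradedAlgebra (σ := σ) (R := K)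
  have h : (Ideal.span s).IsHomogeneous (homogeneousSubmodule σ K) :=
    Ideal.homogeneous_span _ _ fun x hx => by
      obtain ⟨d, -, hd⟩ := hs x hx
      exact ⟨d, hd⟩
  have := h d hp
  rwa [← decomposition.decompose'_apply]

theorem homogeneousComponent_pow_mul_eq_zero {a : MvPolynomial σ K} (ha : PosHomogeneous a)
    (z : MvPolynomial σ K) {d N : ℕ} (h : d < N) :
    homogeneousComponent d (a ^ N * z) = 0 := by
  obtain ⟨e, he, ha⟩ := ha
  have h1 : d < e * N := lt_of_lt_of_le h (Nat.le_mul_of_pos_left _ he)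
  rw [← sum_homogeneousComponent z, Finset.mul_sum, map_sum]
  refine Finset.sum_eq_zero fun i _ => ?_
  rw [homogeneousComponent_of_mem ((ha.pow N).mul (homogeneousComponent_isHomogeneous i z)),
    if_neg (by omega)]

/-- A graded form of the Krull intersection theorem. -/
theorem mem_span_of_forall_pow {s : Set (MvPolynomial σ K)} (hs : ∀ p ∈ s, PosHomogeneous p)
    {a : MvPolynomial σ K} (ha : PosHomogeneous a) {y : MvPolynomial σ K}
    (h : ∀ N, ∃ z, y - a ^ N * z ∈ Ideal.span s) : y ∈ Ideal.span s := by
  rw [← sum_homogeneousComponent y]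
  refine Ideal.sum_mem _ fun d _ => ?_
  -- Since `a` has positive degree, `a ^ (d + 1) * z` has no component in degree `d`.
  obtain ⟨z, hz⟩ := h (d + 1)
  have := homogeneousComponent_mem_span hs hz d
  rwa [map_sub, homogeneousComponent_pow_mul_eq_zero ha z (Nat.lt_succ_self d), sub_zero] at this

/-- The obstruction to swapping `a` and `b` is a submodule `Kk` of a quotient with `Kk = a • Kk`.
Its elements are divisible by every power of `a`, so they vanish by the graded Krull argument. -/
theorem isWeaklyRegular_of_perm {l l' : List (MvPolynomial σ K)}
    (hl : IsWeaklyRegular (MvPolynomial σ K) l) (hp : l.Perm l')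
    (hs : ∀ p ∈ l, PosHomogeneous p) : IsWeaklyRegular (MvPolynomial σ K) l' := by
  refine hl.prototype_perm hp ?_
  intro a b rs hsub Kk hK
  have ha : PosHomogeneous a := hs a (hsub.subset (by simp))
  have hrs : ∀ p ∈ {p | p ∈ rs}, PosHomogeneous p := fun p hp => hs p (hsub.subset (by
    simp only [List.mem_cons]; exact Or.inr (Or.inr hp)))
  have hI : (Ideal.ofList rs • ⊤ : Submodule (MvPolynomial σ K) (MvPolynomial σ K)) =
    Ideal.span {p | p ∈ rs} := by simp [Ideal.ofList]
  rw [eq_bot_iff]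
  intro x hx
  obtain ⟨y, rfl⟩ := Submodule.Quotient.mk_surjective _ x
  rw [Submodule.mem_bot, Submodule.Quotient.mk_eq_zero, hI]
  refine mem_span_of_forall_pow hrs ha fun N => ?_
  have key : ∀ N : ℕ, ∀ x ∈ Kk, ∃ z ∈ Kk, x = a ^ N • z := by
    intro N
    induction N with
    | zero => exact fun x hx => ⟨x, hx, by simp⟩
    | succ N ih =>
      intro x hx
      obtain ⟨z, hz, rfl⟩ := ih x hx
      rw [hK] at hz
      obtain ⟨w, hw, rfl⟩ := hz
      exact ⟨w, hw, by rw [pow_succ, mul_smul]; rfl⟩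
  obtain ⟨z, -, hz⟩ := key N _ hx
  obtain ⟨z, rfl⟩ := Submodule.Quotient.mk_surjective _ z
  refine ⟨z, ?_⟩
  rw [← Submodule.Quotient.mk_smul, Submodule.Quotient.eq, hI] at hz
  exact hz

end Homogeneous

/-! ### Exchanging members of a regular family -/

section Family

variable {K : Type*} [Field K] {σ : Type*} {n : ℕ}

/-- The ideal generated by all members of a family but one. -/
def spanOthers {R : Type*} [CommRing R] (h : Fin n → R) (i : Fin n) : Ideal R :=
  Ideal.span (h '' {i}ᶜ)

theorem mem_spanOthers {R : Type*} [CommRing R] (h : Fin n → R) {i j : Fin n} (hij : j ≠ i) :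
    h j ∈ spanOthers h i := Ideal.subset_span ⟨j, hij, rfl⟩

theorem spanOthers_update {R : Type*} [CommRing R] (h : Fin n → R) (i : Fin n) (b : R) :
    spanOthers (Function.update h i b) i = spanOthers h i := by
  unfold spanOthers
  congr 1
  refine Set.image_congr fun j hj => Function.update_of_ne hj _ _

theorem span_range_eq_sup {R : Type*} [CommRing R] (h : Fin n → R) (i : Fin n) :
    Ideal.span (Set.range h) = spanOthers h i ⊔ Ideal.span {h i} := by
  rw [spanOthers, ← Ideal.span_union, ← Set.image_singleton, ← Set.image_union,
    Set.compl_union_self, Set.image_univ]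

/-- Permutability lets any member be moved to the end, where its regularity is tested against all
the others. Every later exchange rests on this form. -/
theorem isWeaklyRegular_ofFn_iff {h : Fin n → MvPolynomial σ K}
    (hh : ∀ i, PosHomogeneous (h i)) (i : Fin n) :
    IsWeaklyRegular (MvPolynomial σ K) (List.ofFn h) ↔
      IsWeaklyRegular (MvPolynomial σ K) (((List.finRange n).erase i).map h) ∧
        RegularMod (spanOthers h i) (h i) := by
  have hperm : (List.ofFn h).Perm (((List.finRange n).erase i).map h ++ [h i]) := by
    rw [List.ofFn_eq_map]
    refine ((List.perm_cons_erase (List.mem_finRange i)).map h).trans ?_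
    rw [List.map_cons]
    exact (List.perm_append_singleton _ _).symm
  have hmem : ∀ p ∈ List.ofFn h, PosHomogeneous p := by
    intro p hp
    obtain ⟨j, rfl⟩ := List.mem_ofFn.mp hp
    exact hh j
  have h1 : Ideal.ofList (((List.finRange n).erase i).map h) = spanOthers h i := by
    unfold Ideal.ofList spanOthers
    congr 1
    ext p
    simp [List.Nodup.mem_erase_iff (List.nodup_finRange n)]
  rw [← isSMulRegular_quotient_iff, ← h1, ← isWeaklyRegular_singleton_iff,
    ← isWeaklyRegular_append_iff]
  exact ⟨fun H => isWeaklyRegular_of_perm H hperm hmem,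
    fun H => isWeaklyRegular_of_perm H hperm.symm fun p hp => hmem p (hperm.mem_iff.mpr hp)⟩

theorem posHomogeneous_update {h : Fin n → MvPolynomial σ K} (hh : ∀ i, PosHomogeneous (h i))
    {i : Fin n} {b : MvPolynomial σ K} (hb : PosHomogeneous b) (j : Fin n) :
    PosHomogeneous (Function.update h i b j) := by
  rcases eq_or_ne j i with rfl | hj
  · simpa using hb
  · simpa [hj] using hh j

theorem isWeaklyRegular_update {h : Fin n → MvPolynomial σ K} (hh : ∀ i, PosHomogeneous (h i))
    (hW : IsWeaklyRegular (MvPolynomial σ K) (List.ofFn h)) {i : Fin n} {b : MvPolynomial σ K}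
    (hb : PosHomogeneous b) (hreg : RegularMod (spanOthers h i) b) :
    IsWeaklyRegular (MvPolynomial σ K) (List.ofFn (Function.update h i b)) := by
  rw [isWeaklyRegular_ofFn_iff (posHomogeneous_update hh hb) i, spanOthers_update]
  refine ⟨?_, by simpa using hreg⟩
  have := ((isWeaklyRegular_ofFn_iff hh i).mp hW).1
  convert this using 1
  refine List.map_congr_left fun j hj => ?_
  rw [List.Nodup.mem_erase_iff (List.nodup_finRange n)] at hj
  exact Function.update_of_ne hj.1 _ _

theorem RegularMod.const_mul {I : Ideal (MvPolynomial σ K)} {b : MvPolynomial σ K}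
    (h : RegularMod I b) {u : K} (hu : u ≠ 0) : RegularMod I (C u * b) := by
  refine RegularMod.mul (fun y hy => ?_) h
  have := I.mul_mem_left (C u⁻¹) hy
  rwa [← mul_assoc, ← C_mul, inv_mul_cancel₀ hu, C_1, one_mul] at this

/-- Replace one member of a regular family by an invertible combination. -/
theorem isWeaklyRegular_update_add {h : Fin n → MvPolynomial σ K}
    (hh : ∀ i, PosHomogeneous (h i))
    (hW : IsWeaklyRegular (MvPolynomial σ K) (List.ofFn h)) {i : Fin n} {b : MvPolynomial σ K}
    (hb : PosHomogeneous b) {u : K} (hu : u ≠ 0) (hub : b - C u * h i ∈ spanOthers h i) :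
    IsWeaklyRegular (MvPolynomial σ K) (List.ofFn (Function.update h i b)) :=
  isWeaklyRegular_update hh hW hb
    ((((isWeaklyRegular_ofFn_iff hh i).mp hW).2.const_mul hu).congr hub)

theorem span_update_add {h : Fin n → MvPolynomial σ K} {i : Fin n} {b : MvPolynomial σ K}
    {u : K} (hu : u ≠ 0) (hub : b - C u * h i ∈ spanOthers h i) :
    Ideal.span (Set.range (Function.update h i b)) = Ideal.span (Set.range h) := by
  rw [span_range_eq_sup _ i, span_range_eq_sup h i, spanOthers_update, Function.update_self]
  apply le_antisymm
  · refine sup_le le_sup_left ?_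
    rw [Ideal.span_singleton_le_iff_mem]
    have : b = (b - C u * h i) + C u * h i := by ring
    rw [this]
    exact Ideal.add_mem _ (Ideal.mem_sup_left hub)
      (Ideal.mul_mem_left _ _ (Ideal.mem_sup_right (Ideal.mem_span_singleton_self _)))
  · refine sup_le le_sup_left ?_
    rw [Ideal.span_singleton_le_iff_mem]
    have h1 : C u⁻¹ * (C u * h i) = h i := by
      rw [← mul_assoc, ← C_mul, inv_mul_cancel₀ hu, C_1, one_mul]
    have : h i = C u⁻¹ * b - C u⁻¹ * (b - C u * h i) := by rw [mul_sub, h1]; ring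
    rw [this]
    exact Ideal.sub_mem _
      (Ideal.mul_mem_left _ _ (Ideal.mem_sup_right (Ideal.mem_span_singleton_self _)))
      (Ideal.mul_mem_left _ _ (Ideal.mem_sup_left hub))

/-- The family that agrees with `a` below `t` and with `b` from `t` on. -/
def splice {R : Type*} (a b : Fin n → R) (t : ℕ) (i : Fin n) : R :=
  if (i : ℕ) < t then a i else b i

theorem splice_top {R : Type*} (a b : Fin n → R) : splice a b n = a := by
  ext i; simp [splice]

theorem splice_zero {R : Type*} (a b : Fin n → R) : splice a b 0 = b := by
  ext i; simp [splice]

theorem splice_eq_update {R : Type*} (a b : Fin n → R) (i : Fin n) :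
    splice a b i = Function.update (splice a b (i + 1)) i (b i) := by
  ext j
  rcases eq_or_ne j i with rfl | hj
  · simp [splice]
  · have : (j : ℕ) ≠ i := fun h => hj (Fin.ext h)
    have h1 : (j : ℕ) < i ↔ (j : ℕ) < i + 1 := by omega
    simp [splice, hj, h1]

theorem splice_succ_self {R : Type*} (a b : Fin n → R) (i : Fin n) :
    splice a b (i + 1) i = a i := by simp [splice]

theorem mem_spanOthers_splice_of_lt {R : Type*} [CommRing R] (a b : Fin n → R) {i j : Fin n}
    (h : j < i) : a j ∈ spanOthers (splice a b (i + 1)) i := by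
  have : splice a b (i + 1) j = a j := by
    have : (j : ℕ) < i + 1 := by have := Fin.lt_def.mp h; omega
    simp [splice, this]
  rw [← this]
  exact mem_spanOthers _ h.ne

theorem mem_spanOthers_splice_of_gt {R : Type*} [CommRing R] (a b : Fin n → R) {i j : Fin n}
    (h : i < j) : b j ∈ spanOthers (splice a b (i + 1)) i := by
  have : splice a b (i + 1) j = b j := by
    have : ¬ (j : ℕ) < i + 1 := by have := Fin.lt_def.mp h; omega
    simp [splice, this]
  rw [← this]
  exact mem_spanOthers _ h.ne'

theorem posHomogeneous_splice {a b : Fin n → MvPolynomial σ K} (ha : ∀ i, PosHomogeneous (a i))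
    (hb : ∀ i, PosHomogeneous (b i)) (t : ℕ) (i : Fin n) : PosHomogeneous (splice a b t i) := by
  unfold splice
  split_ifs
  exacts [ha i, hb i]

/-- Downward induction along the families `splice a b t`. -/
theorem splice_induction {n : ℕ} {motive : ℕ → Prop} (top : motive n)
    (step : ∀ i : Fin n, motive (i + 1) → motive i) (t : ℕ) (ht : t ≤ n) : motive t := by
  induction ht using Nat.decreasingInduction with
  | self => exact top
  | of_succ k hk ih => exact step ⟨k, hk⟩ ih

/-- Regularity and the generated ideal are unchanged by a triangular change of generators. -/
theorem isWeaklyRegular_and_span_eq_of_triangular {a b : Fin n → MvPolynomial σ K}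
    (ha : ∀ i, PosHomogeneous (a i)) (hb : ∀ i, PosHomogeneous (b i))
    (hW : IsWeaklyRegular (MvPolynomial σ K) (List.ofFn a))
    (h : ∀ i, ∃ u : K, u ≠ 0 ∧ b i - C u * a i ∈ Ideal.span (a '' Set.Iio i)) :
    IsWeaklyRegular (MvPolynomial σ K) (List.ofFn b) ∧
      Ideal.span (Set.range b) = Ideal.span (Set.range a) := by
  have key := splice_induction (n := n)
    (motive := fun t => IsWeaklyRegular (MvPolynomial σ K) (List.ofFn (splice a b t)) ∧
      Ideal.span (Set.range (splice a b t)) = Ideal.span (Set.range a))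
    (by rw [splice_top]; exact ⟨hW, rfl⟩) ?_ 0 (Nat.zero_le _)
  · rwa [splice_zero] at key
  · rintro i ⟨h1, h2⟩
    obtain ⟨u, hu, hi⟩ := h i
    -- At this stage the entries below `i` are still those of `a`, so the triangular hypothesis
    -- applies.
    have hi' : b i - C u * splice a b (i + 1) i ∈ spanOthers (splice a b (i + 1)) i := by
      rw [splice_succ_self]
      refine Ideal.span_le.mpr ?_ hi
      rintro _ ⟨j, hj, rfl⟩
      exact mem_spanOthers_splice_of_lt a b hj
    rw [splice_eq_update]
    exact ⟨isWeaklyRegular_update_add (posHomogeneous_splice ha hb _) h1 (hb i) hu hi',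
      (span_update_add hu hi').trans h2⟩

end Family

/-! ### Elementary symmetric polynomials form a regular sequence -/

section Esymm

variable {K : Type*} [Field K] {n : ℕ}

/-- Membership in an ideal of variables is read off monomials, and multiplication by `x_i` does not
affect the exponents of the variables in `s`. -/
theorem regularMod_span_X {σ : Type*} {s : Set σ} {i : σ} (hi : i ∉ s) :
    RegularMod (Ideal.span ((X : σ → MvPolynomial σ K) '' s)) (X i) := by
  classical
  intro y hy
  rw [mem_ideal_span_X_image] at hy ⊢
  intro m hm
  have h1 : Finsupp.single i 1 + m ∈ (X i * y).support := by
    rw [mem_support_iff, coeff_X_mul]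
    exact mem_support_iff.mp hm
  obtain ⟨j, hj, hj'⟩ := hy _ h1
  have hij : i ≠ j := fun h => hi (h ▸ hj)
  exact ⟨j, hj, by simpa [Finsupp.single_apply, hij] using hj'⟩

theorem isWeaklyRegular_ofFn_X :
    IsWeaklyRegular (MvPolynomial (Fin n) K)
      (List.ofFn (X : Fin n → MvPolynomial (Fin n) K)) := by
  refine ⟨fun i hi => ?_⟩
  rw [isSMulRegular_quotient_iff]
  have hin : i < n := by simpa using hi
  have h1 : Ideal.ofList ((List.ofFn (X : Fin n → MvPolynomial (Fin n) K)).take i) =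
      Ideal.span (X '' Set.Iio (⟨i, hin⟩ : Fin n)) := by
    unfold Ideal.ofList
    congr 1
    ext p
    simp only [Set.mem_ofPred_eq, List.mem_take_iff_getElem, List.getElem_ofFn, Set.mem_image,
      Set.mem_Iio, List.length_ofFn]
    constructor
    · rintro ⟨j, hj, rfl⟩
      exact ⟨⟨j, by omega⟩, by rw [Fin.lt_def]; simp; omega, rfl⟩
    · rintro ⟨j, hj, rfl⟩
      exact ⟨j, by rw [Fin.lt_def] at hj; simp at hj; omega, rfl⟩
  rw [h1, List.getElem_ofFn]
  exact regularMod_span_X (by simp)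

/-- Adding multiples of one member of a regular family to the others. -/
theorem isWeaklyRegular_add_multiples {σ : Type*} {a b : Fin n → MvPolynomial σ K} (k : Fin n)
    (ha : ∀ i, PosHomogeneous (a i)) (hb : ∀ i, PosHomogeneous (b i))
    (hW : IsWeaklyRegular (MvPolynomial σ K) (List.ofFn a)) (hk : b k = a k)
    (h : ∀ i, b i - a i ∈ Ideal.span {a k}) :
    IsWeaklyRegular (MvPolynomial σ K) (List.ofFn b) := by
  have key := splice_induction (n := n)
    (motive := fun t => IsWeaklyRegular (MvPolynomial σ K) (List.ofFn (splice a b t)))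
    (by rwa [splice_top]) ?_ 0 (Nat.zero_le _)
  · rwa [splice_zero] at key
  · intro i h1
    rw [splice_eq_update]
    refine isWeaklyRegular_update_add (posHomogeneous_splice ha hb _) h1 (hb i) one_ne_zero ?_
    rw [splice_succ_self, C_1, one_mul]
    rcases eq_or_ne k i with rfl | hki
    · rw [hk, sub_self]
      exact Ideal.zero_mem _
    · refine (Ideal.span_singleton_le_iff_mem _).mpr ?_ (h i)
      -- The pivot is common to both families, so it is present at every stage.
      have h2 : splice a b (i + 1) k = a k := by
        unfold splice
        split_ifs
        exacts [rfl, hk]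
      rw [← h2]
      exact mem_spanOthers _ hki

variable (K) in
/-- The elementary symmetric polynomial of degree `m` in the variables of `s`. -/
noncomputable def esymmOn {σ : Type*} (s : Finset σ) (m : ℕ) : MvPolynomial σ K :=
  ∑ t ∈ s.powersetCard m, ∏ i ∈ t, X i

theorem isHomogeneous_esymmOn {σ : Type*} (s : Finset σ) (m : ℕ) :
    (esymmOn K s m).IsHomogeneous m := by
  refine IsHomogeneous.sum _ _ _ fun t ht => ?_
  have h := IsHomogeneous.prod t (fun i => (X i : MvPolynomial σ K)) (fun _ => 1)
    fun i _ => isHomogeneous_X K i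
  simpa [(Finset.mem_powersetCard.mp ht).2] using h

theorem posHomogeneous_esymmOn {σ : Type*} (s : Finset σ) (m : ℕ) :
    PosHomogeneous (esymmOn K s (m + 1)) := ⟨m + 1, m.succ_pos, isHomogeneous_esymmOn s _⟩

theorem esymmOn_insert {σ : Type*} [DecidableEq σ] {s : Finset σ} {a : σ} (ha : a ∉ s) (m : ℕ) :
    esymmOn K (insert a s) (m + 1) = esymmOn K s (m + 1) + X a * esymmOn K s m := by
  unfold esymmOn
  rw [Finset.powersetCard_succ_insert ha, Finset.sum_union, Finset.mul_sum]
  · congr 1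
    rw [Finset.sum_image]
    · refine Finset.sum_congr rfl fun t ht => Finset.prod_insert fun h =>
        ha ((Finset.mem_powersetCard.mp ht).1 h)
    · intro t ht t' ht' h
      have h1 : a ∉ t := fun h => ha ((Finset.mem_powersetCard.mp ht).1 h)
      have h2 : a ∉ t' := fun h => ha ((Finset.mem_powersetCard.mp ht').1 h)
      rw [← Finset.erase_insert h1, ← Finset.erase_insert h2]
      exact congrArg (fun u => u.erase a) h
  · rw [Finset.disjoint_left]
    intro t ht ht'
    obtain ⟨u, -, rfl⟩ := Finset.mem_image.mp ht'
    exact ha ((Finset.mem_powersetCard.mp ht).1 (Finset.mem_insert_self a u))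

theorem esymmOn_card {σ : Type*} (s : Finset σ) : esymmOn K s s.card = ∏ i ∈ s, X i := by
  simp [esymmOn]

theorem rename_esymmOn {σ : Type*} (e : Equiv.Perm σ) {s : Finset σ}
    (hs : s.map e.toEmbedding = s) (m : ℕ) : rename e (esymmOn K s m) = esymmOn K s m := by
  conv_rhs => rw [← hs]
  unfold esymmOn
  rw [Finset.powersetCard_map, Finset.sum_map, map_sum]
  refine Finset.sum_congr rfl fun t _ => ?_
  rw [map_prod]
  simp [Finset.mapEmbedding]

/-- The elementary symmetric polynomials in the first `k` variables and the remaining variables. -/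
noncomputable def partialEsymm (K : Type*) [Field K] {n : ℕ} (k : ℕ) :
    Fin n → MvPolynomial (Fin n) K :=
  splice (fun i => esymmOn K (Finset.univ.filter fun j : Fin n => (j : ℕ) < k) (i + 1)) X k

/-- Interpolates between the variables (`k = 0`) and all elementary symmetric polynomials (`k = n`).
Adding multiples of `x_κ` makes the first `k` members symmetric in one more variable; then `x_κ` is
exchanged for the product of the variables of `s'`. -/
theorem isWeaklyRegular_partialEsymm (k : ℕ) (hk : k ≤ n) :
    IsWeaklyRegular (MvPolynomial (Fin n) K) (List.ofFn (partialEsymm K (n := n) k)) := by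
  induction k with
  | zero => rw [partialEsymm, splice_zero]; exact isWeaklyRegular_ofFn_X
  | succ k ih =>
    specialize ih (by omega)
    set κ : Fin n := ⟨k, hk⟩ with hκ
    set s : Finset (Fin n) := Finset.univ.filter fun j : Fin n => (j : ℕ) < k with hs
    set s' : Finset (Fin n) := Finset.univ.filter fun j : Fin n => (j : ℕ) < k + 1 with hs'
    have hks : κ ∉ s := by simp [hs, hκ]
    have hss' : s' = insert κ s := by
      ext j
      simp only [hs, hs', hκ, Finset.mem_filter, Finset.mem_univ, true_and, Finset.mem_insert,
        Fin.ext_iff]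
      omega
    have hcard : s'.card = k + 1 := by
      have : s' = Finset.univ.filter (fun j : Fin n => (j : ℕ) < k + 1) := hs'
      rw [this, Fin.card_filter_val_lt]
      omega
    have hpos : ∀ (s : Finset (Fin n)) (t : ℕ) (i : Fin n), PosHomogeneous
        (splice (fun i : Fin n => esymmOn K s (i + 1)) X t i) := fun s t =>
      posHomogeneous_splice (fun i => posHomogeneous_esymmOn s i) posHomogeneous_X t
    set F : Fin n → MvPolynomial (Fin n) K :=
      splice (fun i => esymmOn K s' (i + 1)) X k with hF
    have hFk : F κ = X κ := by simp [hF, splice, hκ]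
    have hWF : IsWeaklyRegular (MvPolynomial (Fin n) K) (List.ofFn F) := by
      refine isWeaklyRegular_add_multiples κ (hpos s k) (hpos s' k) ih ?_ fun i => ?_
      · rw [hFk]
        simp [splice, hκ]
      · have : splice (fun i : Fin n => esymmOn K s (i + 1)) X k κ = X κ := by simp [splice, hκ]
        rw [this, hF]
        unfold splice
        split_ifs
        · beta_reduce
          rw [hss', esymmOn_insert hks, add_sub_cancel_left]
          exact Ideal.mul_mem_right _ _ (Ideal.mem_span_singleton_self _)
        · rw [sub_self]
          exact Ideal.zero_mem _
    have hupd : partialEsymm K (k + 1) = Function.update F κ (∏ j ∈ s', X j) := by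
      ext1 i
      rcases eq_or_ne i κ with rfl | hi
      · rw [Function.update_self, ← esymmOn_card, hcard]
        simp [partialEsymm, splice, hκ, hs']
      · have h1 : (i : ℕ) ≠ k := fun h => hi (Fin.ext h)
        have h2 : (i : ℕ) < k + 1 ↔ (i : ℕ) < k := by omega
        rw [Function.update_of_ne hi]
        simp [partialEsymm, splice, hF, hs', h2]
    rw [hupd]
    have hposF : ∀ i, PosHomogeneous (F i) := hpos s' k
    have hreg := ((isWeaklyRegular_ofFn_iff hposF κ).mp hWF).2
    rw [hFk] at hreg
    refine isWeaklyRegular_update hposF hWF ?_ (RegularMod.prod _ _ fun j hj => ?_)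
    · rw [← esymmOn_card, hcard]
      exact posHomogeneous_esymmOn s' k
    -- Every member of `F` other than `x_κ` is fixed by the transposition of `j` and `κ`, so the
    -- regularity of `x_κ` modulo them carries over to `x_j`.
    · let e : Equiv.Perm (Fin n) := Equiv.swap j κ
      have hmaps : s'.map e.toEmbedding = s' := by
        refine Finset.map_perm ?_
        intro i hi
        rw [Set.mem_ofPred_eq] at hi
        by_contra his
        refine hi (Equiv.swap_apply_of_ne_of_ne ?_ ?_)
        · rintro rfl; exact his hj
        · rintro rfl; exact his (by rw [hss']; exact Finset.mem_insert_self _ _)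
      have hfix : ∀ i, i ≠ κ → rename e (F i) = F i := by
        intro i hi
        by_cases hik : (i : ℕ) < k
        · have : F i = esymmOn K s' (i + 1) := by simp [hF, splice, hik]
          rw [this]
          exact rename_esymmOn e hmaps _
        · have : F i = X i := by simp [hF, splice, hik]
          rw [this, rename_X, Equiv.swap_apply_of_ne_of_ne _ hi]
          rintro rfl
          have : (i : ℕ) < k + 1 := by simpa [hs'] using hj
          exact hi (Fin.ext (by simp [hκ]; omega))
      have h1 := hreg.map (renameEquiv K e).toRingEquiv
      have h2 : (spanOthers F κ).map (renameEquiv K e).toRingEquiv = spanOthers F κ := by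
        unfold spanOthers
        rw [Ideal.map_span, Set.image_image]
        congr 1
        refine Set.image_congr fun i hi => ?_
        exact hfix i hi
      rw [h2] at h1
      have h3 : (renameEquiv K e).toRingEquiv (X κ) = X j := by
        change rename e (X κ) = X j
        rw [rename_X, Equiv.swap_apply_right]
      rwa [h3] at h1

theorem posHomogeneous_esymm (i : ℕ) : PosHomogeneous (esymm (Fin n) K (i + 1)) :=
  posHomogeneous_esymmOn Finset.univ i

theorem isWeaklyRegular_esymm :
    IsWeaklyRegular (MvPolynomial (Fin n) K)
      (List.ofFn fun i : Fin n => esymm (Fin n) K (i + 1)) := by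
  have h := isWeaklyRegular_partialEsymm (K := K) n le_rfl
  rw [partialEsymm, splice_top] at h
  convert h using 3 with i
  rw [esymm, esymmOn]
  congr 2
  simp

/-- By the fundamental theorem, a symmetric polynomial is `q(e_1, …, e_n)`. Since each `e_i` has
zero constant term, a vanishing constant term passes to `q`, which then lies in the ideal of the
variables. -/
theorem coinvariantIdeal_eq_span_esymm :
    coinvariantIdeal K n = Ideal.span (Set.range fun i : Fin n => esymm (Fin n) K (i + 1)) := by
  apply le_antisymm
  · refine Ideal.span_le.mpr ?_
    rintro p ⟨hp, hp0⟩
    obtain ⟨q, hq⟩ := esymmAlgHom_surjective (σ := Fin n) K (n := n) (by simp) ⟨p, hp⟩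
    have hq' : aeval (fun i : Fin n => esymm (Fin n) K (i + 1)) q = p := by
      rw [← esymmAlgHom_apply, hq]
    have hc : constantCoeff q = 0 := by
      have h : (constantCoeff : MvPolynomial (Fin n) K →+* K).comp
          (aeval (fun i : Fin n => esymm (Fin n) K (i + 1))).toRingHom = constantCoeff := by
        refine MvPolynomial.ringHom_ext (fun r => by simp) fun i => ?_
        simpa using (posHomogeneous_esymm (K := K) (n := n) i).constantCoeff
      rw [← h]
      exact (congrArg constantCoeff hq').trans hp0
    have hmem : q ∈ Ideal.span (Set.range (X : Fin n → MvPolynomial (Fin n) K)) := by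
      rw [← Set.image_univ, mem_ideal_span_X_image]
      intro m hm
      by_contra! hcon
      have hm0 : m = 0 := Finsupp.ext fun i => hcon i (Set.mem_univ i)
      rw [mem_support_iff, hm0, ← constantCoeff_eq] at hm
      exact hm hc
    have := Ideal.mem_map_of_mem (aeval (fun i : Fin n => esymm (Fin n) K (i + 1))) hmem
    rw [hq', Ideal.map_span, ← Set.range_comp] at this
    have hX : aeval (fun i : Fin n => esymm (Fin n) K (i + 1)) ∘
        (X : Fin n → MvPolynomial (Fin n) K) = fun i : Fin n => esymm (Fin n) K (i + 1) :=
      funext fun i => aeval_X _ _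
    rwa [hX] at this
  · refine Ideal.span_le.mpr ?_
    rintro _ ⟨i, rfl⟩
    exact Ideal.subset_span ⟨esymm_isSymmetric _ _ _, (posHomogeneous_esymm _).constantCoeff⟩

end Esymm

/-! ### Congruences between the generators for `J` and for `insert m J` -/

section Relations

variable {K : Type*} [Field K] {n : ℕ} (J : Finset (Fin n))

variable (K) in
/-- `∑_{k ≥ a} (∏_{j ∉ J, j < a} (x_j - x_k)) x_k`. -/
noncomputable def tailSum (a : ℕ) : MvPolynomial (Fin n) K :=
  ∑ k ∈ Finset.univ.filter (fun k : Fin n => a ≤ k),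
    (∏ j ∈ Finset.univ.filter (fun j : Fin n => j ∉ J ∧ (j : ℕ) < a), (X j - X k)) * X k

variable {J}

theorem gPoly_of_notMem {i : Fin n} (hi : i ∉ J) : gPoly K J i = tailSum K J i := by
  rw [gPoly, if_pos hi]
  rfl

theorem gPoly_of_mem {i : Fin n} (hi : i ∈ J) : gPoly K J i =
    ∏ j ∈ Finset.univ.filter (fun j => j ∉ J ∧ j < i), (X j - X i) := by
  rw [gPoly, if_neg (not_not.mpr hi)]

theorem filter_le_eq_insert (i : Fin n) :
    Finset.univ.filter (fun k : Fin n => (i : ℕ) ≤ k) =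
      insert i (Finset.univ.filter (fun k : Fin n => (i : ℕ) + 1 ≤ k)) := by
  ext k
  simp only [Finset.mem_filter, Finset.mem_univ, true_and, Finset.mem_insert, Fin.ext_iff]
  omega

theorem filter_lt_succ_of_mem {i : Fin n} (hi : i ∈ J) :
    Finset.univ.filter (fun j : Fin n => j ∉ J ∧ (j : ℕ) < i + 1) =
      Finset.univ.filter (fun j : Fin n => j ∉ J ∧ (j : ℕ) < i) := by
  refine Finset.filter_congr fun j _ => and_congr_right fun hj => ?_
  have : (j : ℕ) ≠ i := fun h => hj (Fin.ext h ▸ hi)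
  omega

theorem filter_lt_succ_of_notMem {i : Fin n} (hi : i ∉ J) :
    Finset.univ.filter (fun j : Fin n => j ∉ J ∧ (j : ℕ) < i + 1) =
      insert i (Finset.univ.filter (fun j : Fin n => j ∉ J ∧ (j : ℕ) < i)) := by
  ext j
  simp only [Finset.mem_filter, Finset.mem_univ, true_and, Finset.mem_insert]
  constructor
  · rintro ⟨h1, h2⟩
    rcases eq_or_ne j i with h | h
    · exact Or.inl h
    · exact Or.inr ⟨h1, by have : (j : ℕ) ≠ i := fun h' => h (Fin.ext h'); omega⟩
  · rintro (rfl | ⟨h1, h2⟩)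
    · exact ⟨hi, by omega⟩
    · exact ⟨h1, by omega⟩

theorem filter_insert_of_lt {m : Fin n} (hm : m ∉ J) {a : ℕ} (ha : (m : ℕ) < a) :
    Finset.univ.filter (fun j : Fin n => j ∉ J ∧ (j : ℕ) < a) =
      insert m (Finset.univ.filter (fun j : Fin n => j ∉ insert m J ∧ (j : ℕ) < a)) := by
  ext j
  simp only [Finset.mem_filter, Finset.mem_univ, true_and, Finset.mem_insert, not_or]
  constructor
  · rintro ⟨h1, h2⟩
    exact (em (j = m)).imp id fun h => ⟨⟨h, h1⟩, h2⟩
  · rintro (rfl | ⟨⟨-, h1⟩, h2⟩)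
    exacts [⟨hm, ha⟩, ⟨h1, h2⟩]

theorem filter_insert_of_le {m : Fin n} {a : ℕ} (ha : a ≤ (m : ℕ)) :
    Finset.univ.filter (fun j : Fin n => j ∉ insert m J ∧ (j : ℕ) < a) =
      Finset.univ.filter (fun j : Fin n => j ∉ J ∧ (j : ℕ) < a) := by
  refine Finset.filter_congr fun j _ => ?_
  rw [Finset.mem_insert, not_or]
  refine ⟨fun h => ⟨h.1.2, h.2⟩, fun h => ⟨⟨?_, h.1⟩, h.2⟩⟩
  rintro rfl
  omega

/-- An index `i ∈ J` contributes no factor, so raising the bound to `i + 1` only drops the summand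
`k = i`. -/
theorem tailSum_of_mem {i : Fin n} (hi : i ∈ J) :
    tailSum K J i = X i * gPoly K J i + tailSum K J (i + 1) := by
  rw [tailSum, filter_le_eq_insert, Finset.sum_insert (by simp), gPoly_of_mem hi, tailSum,
    filter_lt_succ_of_mem hi, mul_comm (X i)]
  rfl

theorem tailSum_insert_of_le {m : Fin n} {a : ℕ} (ha : a ≤ (m : ℕ)) :
    tailSum K (insert m J) a = tailSum K J a := by
  unfold tailSum
  rw [filter_insert_of_le ha]

/-- Indices in `J` are peeled off until the bound reaches an index outside `J`, where the tail sum
is itself a generator. -/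
theorem tailSum_mem_span (a : ℕ) (ha : a ≤ n) :
    tailSum K J a ∈ Ideal.span (gPoly K J '' {k | a ≤ (k : ℕ)}) := by
  refine splice_induction (n := n)
    (motive := fun a => tailSum K J a ∈ Ideal.span (gPoly K J '' {k | a ≤ (k : ℕ)}))
    ?_ ?_ a ha
  · have : Finset.univ.filter (fun k : Fin n => n ≤ k) = ∅ := by
      ext k
      simp
    rw [tailSum, this, Finset.sum_empty]
    exact Ideal.zero_mem _
  · intro i ih
    have hmem : gPoly K J i ∈ Ideal.span (gPoly K J '' {k | (i : ℕ) ≤ (k : ℕ)}) :=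
      Ideal.subset_span ⟨i, le_refl (i : ℕ), rfl⟩
    by_cases hi : i ∈ J
    · rw [tailSum_of_mem hi]
      refine Ideal.add_mem _ (Ideal.mul_mem_left _ _ hmem) (Ideal.span_mono ?_ ih)
      refine Set.image_mono fun k hk => ?_
      exact (Nat.le_succ _).trans hk
    · rwa [← gPoly_of_notMem hi]

theorem tailSum_succ_mem_span (i : Fin n) :
    tailSum K J (i + 1) ∈ Ideal.span (gPoly K J '' Set.Ioi i) :=
  tailSum_mem_span (i + 1) i.isLt

theorem gPoly_insert_of_lt {m i : Fin n} (h : i < m) :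
    gPoly K (insert m J) i = gPoly K J i := by
  by_cases hi : i ∈ J
  · rw [gPoly_of_mem hi, gPoly_of_mem (Finset.mem_insert_of_mem hi)]
    exact Finset.prod_congr (filter_insert_of_le (Fin.lt_def.mp h).le) fun _ _ => rfl
  · rw [gPoly_of_notMem hi, gPoly_of_notMem, tailSum_insert_of_le (Fin.lt_def.mp h).le]
    rw [Finset.mem_insert, not_or]
    exact ⟨h.ne, hi⟩

variable (K) in
/-- The linear factors `x_m` and `x_m - x_i` of `f_{ {m} }`. -/
noncomputable def linearFactor (m i : Fin n) : MvPolynomial (Fin n) K :=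
  if i = m then X m else X m - X i

/-- For `i = m` the remainder is a tail sum, by peeling off the summand `k = m`. For `i > m` in `J`
there is none. For `i > m` outside `J`, the identity `(x_m - x_k) - (x_m - x_i) = x_i - x_k` turns
it into the tail sum starting at `i + 1`. -/
theorem gPoly_sub_mem_span {m i : Fin n} (hm : m ∉ J) (h : m ≤ i) :
    gPoly K J i - linearFactor K m i * gPoly K (insert m J) i ∈
      Ideal.span (gPoly K (insert m J) '' Set.Ioi i) := by
  rcases eq_or_ne i m with rfl | hne
  · rw [gPoly_of_notMem hm, ← tailSum_insert_of_le le_rfl, tailSum_of_mem (by simp), linearFactor,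
      if_pos rfl, add_sub_cancel_left]
    exact tailSum_succ_mem_span i
  have hlt : m < i := lt_of_le_of_ne h hne.symm
  have hnot : m ∉ Finset.univ.filter
      (fun j : Fin n => j ∉ insert m J ∧ (j : ℕ) < (i : ℕ)) := by simp
  rw [linearFactor, if_neg hne]
  by_cases hi : i ∈ J
  · have : gPoly K J i = (X m - X i) * gPoly K (insert m J) i := by
      rw [gPoly_of_mem hi, gPoly_of_mem (Finset.mem_insert_of_mem hi)]
      exact (Finset.prod_congr (filter_insert_of_lt hm (Fin.lt_def.mp hlt)) fun _ _ => rfl).trans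
        (Finset.prod_insert hnot)
    rw [this, sub_self]
    exact Ideal.zero_mem _
  · have hi' : i ∉ insert m J := by
      rw [Finset.mem_insert, not_or]
      exact ⟨hne, hi⟩
    have : gPoly K J i - (X m - X i) * gPoly K (insert m J) i =
        tailSum K (insert m J) (i + 1) := by
      have hnot' : i ∉ Finset.univ.filter
          (fun j : Fin n => j ∉ insert m J ∧ (j : ℕ) < (i : ℕ)) := by simp
      rw [gPoly_of_notMem hi, gPoly_of_notMem hi', tailSum, tailSum, Finset.mul_sum,
        ← Finset.sum_sub_distrib, filter_insert_of_lt hm (Fin.lt_def.mp hlt),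
        filter_le_eq_insert, Finset.sum_insert (by simp), tailSum, filter_lt_succ_of_notMem hi']
      have h0 : ∀ k, (∏ j ∈ insert m (Finset.univ.filter
          (fun j : Fin n => j ∉ insert m J ∧ (j : ℕ) < (i : ℕ))), (X j - X k)) * X k -
          (X m - X i) * ((∏ j ∈ Finset.univ.filter
          (fun j : Fin n => j ∉ insert m J ∧ (j : ℕ) < (i : ℕ)), (X j - X k)) * X k) =
          (∏ j ∈ insert i (Finset.univ.filter
          (fun j : Fin n => j ∉ insert m J ∧ (j : ℕ) < (i : ℕ))),
            (X j - X k : MvPolynomial (Fin n) K)) * X k := by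
        intro k
        rw [Finset.prod_insert hnot, Finset.prod_insert hnot']
        ring
      -- The summand `k = i` vanishes because of its new factor `x_i - x_i`.
      rw [h0, Finset.prod_insert hnot', sub_self, zero_mul, zero_mul, zero_add]
      exact Finset.sum_congr rfl fun k _ => h0 k
    rw [this]
    exact tailSum_succ_mem_span i

theorem posHomogeneous_tailSum (a : ℕ) : PosHomogeneous (tailSum K J a) := by
  refine ⟨_ , Nat.succ_pos _, IsHomogeneous.sum _ _ ((Finset.univ.filter
    (fun j : Fin n => j ∉ J ∧ (j : ℕ) < a)).card + 1) fun k _ => ?_⟩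
  refine IsHomogeneous.mul ?_ (isHomogeneous_X _ _)
  have h := IsHomogeneous.prod (Finset.univ.filter (fun j : Fin n => j ∉ J ∧ (j : ℕ) < a))
    (fun j => (X j - X k : MvPolynomial (Fin n) K)) (fun _ => 1)
    fun j _ => (isHomogeneous_X K j).sub (isHomogeneous_X K k)
  simpa using h

theorem posHomogeneous_gPoly {o : Fin n} (ho : (o : ℕ) = 0) (hJ : o ∉ J) (i : Fin n) :
    PosHomogeneous (gPoly K J i) := by
  by_cases hi : i ∈ J
  · rw [gPoly_of_mem hi]
    have h := IsHomogeneous.prod (Finset.univ.filter (fun j : Fin n => j ∉ J ∧ j < i))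
      (fun j => (X j - X i : MvPolynomial (Fin n) K)) (fun _ => 1)
      fun j _ => (isHomogeneous_X K j).sub (isHomogeneous_X K i)
    refine ⟨_, ?_, h⟩
    rw [Finset.sum_const, smul_eq_mul, mul_one, Finset.card_pos]
    -- The factor indexed by `o` makes the degree positive.
    refine ⟨o, ?_⟩
    have : (i : ℕ) ≠ o := fun h => hJ (Fin.ext h ▸ hi)
    simp only [Finset.mem_filter, Finset.mem_univ, true_and, Fin.lt_def]
    exact ⟨hJ, by omega⟩
  · rw [gPoly_of_notMem hi]
    exact posHomogeneous_tailSum _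

end Relations

/-! ### The case `J = ∅`: power sums and Newton's identities -/

section Coinvariants

variable {K : Type*} [Field K] {n : ℕ}

/-- Expand the product in powers of `x_k`: the top power gives the stated multiple of a power sum,
and all lower powers give multiples of earlier power sums. -/
theorem sum_prod_sub_mul_pow_mem (T : Finset (Fin n)) (s : ℕ) :
    ∑ k, (∏ j ∈ T, (X j - X k)) * X k ^ s - C ((-1) ^ T.card) * psum (Fin n) K (s + T.card) ∈
      Ideal.span (psum (Fin n) K '' Set.Ico s (s + T.card)) := by
  induction T using Finset.induction_on generalizing s with
  | empty => simp [psum]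
  | insert a T ha ih =>
    have hcard : (insert a T).card = T.card + 1 := Finset.card_insert_of_notMem ha
    rw [hcard]
    have hmono : ∀ {b c : ℕ}, s ≤ b → c ≤ s + (T.card + 1) →
        Ideal.span (psum (Fin n) K '' Set.Ico b c) ≤
          Ideal.span (psum (Fin n) K '' Set.Ico s (s + (T.card + 1))) := fun hb hc =>
      Ideal.span_mono (Set.image_mono (Set.Ico_subset_Ico hb hc))
    have h1 := hmono (le_refl s) (by omega) (ih s)
    have h2 := hmono (Nat.le_succ s) (by omega) (ih (s + 1))
    have h3 : psum (Fin n) K (s + T.card) ∈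
        Ideal.span (psum (Fin n) K '' Set.Ico s (s + (T.card + 1))) :=
      Ideal.subset_span ⟨_, ⟨by omega, by omega⟩, rfl⟩
    have hsum : ∑ k, (∏ j ∈ insert a T, (X j - X k)) * X k ^ s =
        X a * ∑ k, (∏ j ∈ T, (X j - X k : MvPolynomial (Fin n) K)) * X k ^ s -
          ∑ k, (∏ j ∈ T, (X j - X k)) * X k ^ (s + 1) := by
      rw [Finset.mul_sum, ← Finset.sum_sub_distrib]
      refine Finset.sum_congr rfl fun k _ => ?_
      rw [Finset.prod_insert ha]
      ring
    have hidx : s + 1 + T.card = s + (T.card + 1) := by omega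
    rw [hidx] at h2
    have := Ideal.add_mem _ (Ideal.sub_mem _ (Ideal.mul_mem_left _ (X a) h1) h2)
      (Ideal.mul_mem_left _ (X a * C ((-1) ^ T.card)) h3)
    convert this using 1
    rw [hsum, pow_succ, C_mul, C_neg, C_1]
    ring

/-- The sum may run over all `k`, since for `k < i` the factor with `j = k` is zero. -/
theorem gPoly_empty (i : Fin n) :
    gPoly K ∅ i = ∑ k, (∏ j ∈ Finset.univ.filter (fun j => j < i), (X j - X k)) * X k ^ 1 := by
  rw [gPoly, if_pos (by simp)]
  simp only [pow_one, Finset.notMem_empty, not_false_eq_true, true_and]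
  refine Finset.sum_subset (Finset.subset_univ _) fun k _ hk => ?_
  have hk' : k < i := by simpa using hk
  rw [Finset.prod_eq_zero (i := k) (by simpa using hk') (sub_self _), zero_mul]

theorem psum_sub_mem_span_esymm (k : ℕ) :
    psum (Fin n) K (k + 1) - C ((-1) ^ k * (k + 1 : K)) * esymm (Fin n) K (k + 1) ∈
      Ideal.span ((fun j => esymm (Fin n) K (j + 1)) '' Set.Iio k) := by
  rw [psum_eq_mul_esymm_sub_sum _ _ _ k.succ_pos]
  have hC : (C ((-1) ^ k * (k + 1 : K)) : MvPolynomial (Fin n) K) =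
      (-1) ^ (k + 1 + 1) * ((k + 1 : ℕ) : MvPolynomial (Fin n) K) := by
    simp [pow_succ]
  rw [hC, sub_sub_cancel_left]
  refine neg_mem (Ideal.sum_mem _ fun a ha => ?_)
  rw [Finset.mem_filter] at ha
  obtain ⟨-, h1, h2⟩ := ha
  refine Ideal.mul_mem_right _ _ (Ideal.mul_mem_left _ _ (Ideal.subset_span ⟨a.1 - 1, ?_, ?_⟩))
  · simp only [Set.mem_Iio]
    omega
  · have : a.1 - 1 + 1 = a.1 := by omega
    simp only [this]

theorem gPoly_empty_sub_mem_span [CharZero K] (i : Fin n) :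
    ∃ u : K, u ≠ 0 ∧ gPoly K ∅ i - C u * esymm (Fin n) K (i + 1) ∈
      Ideal.span ((fun i : Fin n => esymm (Fin n) K (i + 1)) '' Set.Iio i) := by
  -- The first sign comes from expanding the product, the remaining factor from Newton's identity;
  -- `i + 1 ≠ 0` uses characteristic `0`.
  refine ⟨(-1) ^ (i : ℕ) * ((-1) ^ (i : ℕ) * ((i : ℕ) + 1 : K)), ?_, ?_⟩
  · refine mul_ne_zero (by simp) (mul_ne_zero (by simp) ?_)
    exact Nat.cast_add_one_ne_zero _
  have himg : ((fun i : Fin n => esymm (Fin n) K (i + 1)) '' Set.Iio i) =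
      ((fun j => esymm (Fin n) K (j + 1)) '' Set.Iio (i : ℕ)) := by
    ext p
    constructor
    · rintro ⟨j, hj, rfl⟩
      exact ⟨j, hj, rfl⟩
    · rintro ⟨j, hj, rfl⟩
      exact ⟨⟨j, lt_trans hj i.isLt⟩, hj, rfl⟩
  have hcard : (Finset.univ.filter (fun j : Fin n => j < i)).card = i := by
    exact (Fin.card_filter_val_lt (n := n) (m := i)).trans (min_eq_right i.isLt.le)
  have h1 := sum_prod_sub_mul_pow_mem (K := K) (Finset.univ.filter (fun j : Fin n => j < i)) 1
  rw [← gPoly_empty, hcard, add_comm 1] at h1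
  have h2 : Ideal.span (psum (Fin n) K '' Set.Ico 1 (i + 1)) ≤
      Ideal.span ((fun j => esymm (Fin n) K (j + 1)) '' Set.Iio (i : ℕ)) := by
    refine Ideal.span_le.mpr ?_
    rintro _ ⟨r, ⟨hr1, hr2⟩, rfl⟩
    obtain ⟨r, rfl⟩ := Nat.exists_eq_succ_of_ne_zero (by omega : r ≠ 0)
    have h := Ideal.span_mono (Set.image_mono (Set.Iio_subset_Iio (by omega : r ≤ i)))
      (psum_sub_mem_span_esymm (K := K) (n := n) r)
    have h' : esymm (Fin n) K (r + 1) ∈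
        Ideal.span ((fun j => esymm (Fin n) K (j + 1)) '' Set.Iio (i : ℕ)) :=
      Ideal.subset_span ⟨r, by simp only [Set.mem_Iio]; omega, rfl⟩
    have := Ideal.add_mem _ h (Ideal.mul_mem_left _ (C ((-1) ^ r * (r + 1 : K))) h')
    rwa [sub_add_cancel] at this
  rw [himg]
  have := Ideal.add_mem _ (h2 h1) (Ideal.mul_mem_left _ (C ((-1) ^ (i : ℕ)))
    (psum_sub_mem_span_esymm (K := K) (n := n) i))
  convert this using 1
  rw [C_mul (a := (-1) ^ (i : ℕ))]
  ring

theorem isWeaklyRegular_and_span_gPoly_empty [CharZero K] :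
    IsWeaklyRegular (MvPolynomial (Fin n) K) (List.ofFn (gPoly K (∅ : Finset (Fin n)))) ∧
      Ideal.span (Set.range (gPoly K (∅ : Finset (Fin n)))) = coinvariantIdeal K n := by
  rw [coinvariantIdeal_eq_span_esymm]
  refine isWeaklyRegular_and_span_eq_of_triangular (fun i => posHomogeneous_esymm i)
    (fun i => ?_) isWeaklyRegular_esymm gPoly_empty_sub_mem_span
  rw [gPoly_of_notMem (by simp)]
  exact posHomogeneous_tailSum _

end Coinvariants

/-! ### The colon ideal, by induction on `J` -/

section Colon

variable {K : Type*} [Field K] {n : ℕ} {J : Finset (Fin n)}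

variable (K J) in
/-- The families interpolating between the generators for `J` and those for `insert m J`. -/
noncomputable def gSplice (m : Fin n) (t : ℕ) : Fin n → MvPolynomial (Fin n) K :=
  splice (gPoly K J) (gPoly K (insert m J)) t

/-- The exchange can stop at `m` because the two families agree below it. -/
theorem gSplice_bot (m : Fin n) : gSplice K J m m = gPoly K (insert m J) := by
  ext1 i
  unfold gSplice splice
  split_ifs with h
  exacts [(gPoly_insert_of_lt h).symm, rfl]

theorem gPoly_sub_mem_spanOthers {m i : Fin n} (hm : m ∉ J) (h : m ≤ i) :
    gPoly K J i - linearFactor K m i * gPoly K (insert m J) i ∈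
      spanOthers (gSplice K J m (i + 1)) i := by
  refine Ideal.span_le.mpr ?_ (gPoly_sub_mem_span hm h)
  rintro _ ⟨j, hj, rfl⟩
  exact mem_spanOthers_splice_of_gt _ _ hj

theorem span_gSplice_succ {m i : Fin n} (hm : m ∉ J) (h : m ≤ i) :
    Ideal.span (Set.range (gSplice K J m (i + 1))) =
      spanOthers (gSplice K J m (i + 1)) i ⊔
        Ideal.span {linearFactor K m i * gPoly K (insert m J) i} := by
  have hg := gPoly_sub_mem_spanOthers (K := K) hm h
  rw [span_range_eq_sup _ i]
  have h1 : gSplice K J m (i + 1) i = gPoly K J i := splice_succ_self _ _ i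
  rw [h1]
  apply le_antisymm <;> refine sup_le le_sup_left ?_ <;>
    rw [Ideal.span_singleton_le_iff_mem]
  · rw [← sub_add_cancel (gPoly K J i) (linearFactor K m i * gPoly K (insert m J) i)]
    exact Ideal.add_mem _ (Ideal.mem_sup_left hg)
      (Ideal.mem_sup_right (Ideal.mem_span_singleton_self _))
  · rw [← sub_sub_cancel (gPoly K J i) (linearFactor K m i * gPoly K (insert m J) i)]
    exact Ideal.sub_mem _ (Ideal.mem_sup_right (Ideal.mem_span_singleton_self _))
      (Ideal.mem_sup_left hg)

theorem span_gSplice (m i : Fin n) :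
    Ideal.span (Set.range (gSplice K J m i)) =
      spanOthers (gSplice K J m (i + 1)) i ⊔ Ideal.span {gPoly K (insert m J) i} := by
  rw [gSplice, splice_eq_update, span_range_eq_sup _ i, spanOthers_update, Function.update_self,
    gSplice]

theorem linearFactor_mul_mem {m i : Fin n} (hm : m ∉ J) (h : m ≤ i)
    {y : MvPolynomial (Fin n) K} (hy : y ∈ Ideal.span (Set.range (gSplice K J m i))) :
    linearFactor K m i * y ∈ Ideal.span (Set.range (gSplice K J m (i + 1))) := by
  rw [span_gSplice_succ hm h]
  rw [span_gSplice, Submodule.mem_sup] at hy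
  obtain ⟨u, hu, v, hv, rfl⟩ := hy
  obtain ⟨w, rfl⟩ := Ideal.mem_span_singleton'.mp hv
  rw [mul_add]
  refine Ideal.add_mem _ (Ideal.mem_sup_left (Ideal.mul_mem_left _ _ hu)) (Ideal.mem_sup_right ?_)
  exact Ideal.mem_span_singleton'.mpr ⟨w, by ring⟩

variable (K) in
/-- `f_{ {m} }` as the product of its linear factors. -/
theorem prod_linearFactor (m : Fin n) :
    ∏ i ∈ Finset.univ.filter (fun i : Fin n => (m : ℕ) ≤ i), linearFactor K m i =
      X m * ∏ i ∈ Finset.univ.filter (fun i => m < i), (X m - X i) := by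
  rw [filter_le_eq_insert, Finset.prod_insert (by simp), linearFactor, if_pos rfl]
  congr 1
  refine Finset.prod_congr rfl fun i hi => ?_
  have hi' : (m : ℕ) < i := by simpa using hi
  rw [linearFactor, if_neg (fun h => by simp [h] at hi')]

theorem prod_linearFactor_ge (m i : Fin n) :
    ∏ k ∈ Finset.univ.filter (fun k : Fin n => (i : ℕ) ≤ k), linearFactor K m k =
      linearFactor K m i *
        ∏ k ∈ Finset.univ.filter (fun k : Fin n => (i : ℕ) + 1 ≤ k), linearFactor K m k := by
  rw [filter_le_eq_insert, Finset.prod_insert (by simp)]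

theorem filter_top_le : Finset.univ.filter (fun k : Fin n => n ≤ (k : ℕ)) = ∅ := by
  ext k
  simp

/-- This inclusion uses only `ℓ (I + (b)) ⊆ I + (ℓ b)` and no regularity, so it also serves the case
where the first index lies in `J`. -/
theorem prod_linearFactor_mul_mem {m : Fin n} (hm : m ∉ J) {y : MvPolynomial (Fin n) K}
    (hy : y ∈ Ideal.span (Set.range (gPoly K (insert m J)))) :
    (X m * ∏ i ∈ Finset.univ.filter (fun i => m < i), (X m - X i)) * y ∈
      Ideal.span (Set.range (gPoly K J)) := by
  have key := splice_induction (n := n) (motive := fun t => (m : ℕ) ≤ t →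
    ∀ y ∈ Ideal.span (Set.range (gSplice K J m t)),
      (∏ k ∈ Finset.univ.filter (fun k : Fin n => t ≤ k), linearFactor K m k) * y ∈
        Ideal.span (Set.range (gPoly K J))) ?_ ?_ m m.isLt.le le_rfl y (by rwa [gSplice_bot])
  · rwa [prod_linearFactor] at key
  · intro _ y hy
    rw [filter_top_le, Finset.prod_empty, one_mul]
    rwa [gSplice, splice_top] at hy
  · intro i ih hi y hy
    have := ih (by omega) _ (linearFactor_mul_mem hm hi hy)
    rw [prod_linearFactor_ge]
    convert this using 1
    ring

/-- The converse inclusion is proved together with regularity: regularity of `ℓ b` modulo the other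
members gives that of `b`, which keeps the family regular, and that of `ℓ`, which allows
cancellation. -/
theorem gPoly_insert_step {o : Fin n} (ho : (o : ℕ) = 0) {m : Fin n} (hm : m ∉ J)
    (hoJ : o ∉ insert m J)
    (hW : IsWeaklyRegular (MvPolynomial (Fin n) K) (List.ofFn (gPoly K J))) :
    IsWeaklyRegular (MvPolynomial (Fin n) K) (List.ofFn (gPoly K (insert m J))) ∧
      ∀ y, (X m * ∏ i ∈ Finset.univ.filter (fun i => m < i), (X m - X i)) * y ∈
        Ideal.span (Set.range (gPoly K J)) → y ∈ Ideal.span (Set.range (gPoly K (insert m J))) := by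
  have hpos : ∀ t i, PosHomogeneous (gSplice K J m t i) := fun t =>
    posHomogeneous_splice
      (posHomogeneous_gPoly ho fun h => hoJ (Finset.mem_insert_of_mem h))
      (posHomogeneous_gPoly ho hoJ) t
  have key := splice_induction (n := n) (motive := fun t => (m : ℕ) ≤ t →
    IsWeaklyRegular (MvPolynomial (Fin n) K) (List.ofFn (gSplice K J m t)) ∧
    ∀ y, (∏ k ∈ Finset.univ.filter (fun k : Fin n => t ≤ k), linearFactor K m k) * y ∈
        Ideal.span (Set.range (gPoly K J)) → y ∈ Ideal.span (Set.range (gSplice K J m t)))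
    ?_ ?_ m m.isLt.le le_rfl
  · rwa [prod_linearFactor, gSplice_bot] at key
  · intro _
    rw [filter_top_le, gSplice, splice_top]
    exact ⟨hW, fun y hy => by simpa using hy⟩
  · intro i ih hi
    obtain ⟨h1, h2⟩ := ih (by omega)
    have hreg := ((isWeaklyRegular_ofFn_iff (hpos (i + 1)) i).mp h1).2
    have hg := gPoly_sub_mem_spanOthers (K := K) hm hi
    rw [gSplice, splice_succ_self, ← gSplice] at hreg
    have hreg' : RegularMod (spanOthers (gSplice K J m (i + 1)) i)
        (linearFactor K m i * gPoly K (insert m J) i) :=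
      hreg.congr (by rw [← neg_sub]; exact neg_mem hg)
    refine ⟨?_, fun y hy => ?_⟩
    · have := isWeaklyRegular_update (hpos (i + 1)) h1 (posHomogeneous_gPoly ho hoJ i)
        hreg'.of_mul_right
      rwa [gSplice, splice_eq_update]
    · rw [prod_linearFactor_ge, mul_comm (linearFactor K m i), mul_assoc] at hy
      have hy' := h2 _ hy
      rw [span_gSplice_succ hm hi, Submodule.mem_sup] at hy'
      obtain ⟨u, hu, v, hv, huv⟩ := hy'
      obtain ⟨w, rfl⟩ := Ideal.mem_span_singleton'.mp hv
      -- From `ℓ y = u + w ℓ b` with `u` in the ideal of the other members, cancel `ℓ` in `ℓ (y - w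
      -- b) = u`.
      have hz : y - w * gPoly K (insert m J) i ∈ spanOthers (gSplice K J m (i + 1)) i := by
        refine hreg'.of_mul_left _ ?_
        have : linearFactor K m i * (y - w * gPoly K (insert m J) i) = u := by
          rw [mul_sub, ← huv]
          ring
        rwa [this]
      rw [span_gSplice, ← sub_add_cancel y (w * gPoly K (insert m J) i)]
      exact Ideal.add_mem _ (Ideal.mem_sup_left hz)
        (Ideal.mem_sup_right (Ideal.mem_span_singleton'.mpr ⟨w, rfl⟩))

theorem fPoly_insert {m : Fin n} (hm : m ∉ J) : fPoly K (insert m J) =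
    (X m * ∏ i ∈ Finset.univ.filter (fun i => m < i), (X m - X i)) * fPoly K J :=
  Finset.prod_insert hm

/-- Iterated colons: `f_J` gains the factor `f_{ {m} }` when `m` is added, in whatever order the
elements of `J` come. -/
theorem isWeaklyRegular_and_colonIdeal [CharZero K] {o : Fin n} (ho : (o : ℕ) = 0) (hJ : o ∉ J) :
    IsWeaklyRegular (MvPolynomial (Fin n) K) (List.ofFn (gPoly K J)) ∧
      colonIdeal K J = Ideal.span (Set.range (gPoly K J)) := by
  induction J using Finset.induction_on with
  | empty =>
    obtain ⟨h1, h2⟩ := isWeaklyRegular_and_span_gPoly_empty (K := K) (n := n)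
    refine ⟨h1, ?_⟩
    ext y
    rw [mem_colonIdeal, h2, fPoly, Finset.prod_empty, one_mul]
  | insert m J hm ih =>
    obtain ⟨h1, h2⟩ := ih fun h => hJ (Finset.mem_insert_of_mem h)
    obtain ⟨h3, h4⟩ := gPoly_insert_step ho hm hJ h1
    refine ⟨h3, ?_⟩
    have hiff : ∀ y, y ∈ colonIdeal K (insert m J) ↔
        (X m * ∏ i ∈ Finset.univ.filter (fun i => m < i), (X m - X i)) * y ∈
          Ideal.span (Set.range (gPoly K J)) := by
      intro y
      rw [← h2, mem_colonIdeal, mem_colonIdeal, fPoly_insert hm, ← mul_assoc,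
        mul_comm (fPoly K J)]
    ext y
    rw [hiff]
    exact ⟨h4 y, prod_linearFactor_mul_mem hm⟩

theorem gPoly_zero_of_mem {o : Fin n} (ho : (o : ℕ) = 0) (hJ : o ∈ J) : gPoly K J o = 1 := by
  rw [gPoly_of_mem hJ]
  refine Finset.prod_eq_one fun j hj => ?_
  rw [Finset.mem_filter, Fin.lt_def] at hj
  omega

theorem span_gPoly_eq_top {o : Fin n} (ho : (o : ℕ) = 0) (hJ : o ∈ J) :
    Ideal.span (Set.range (gPoly K J)) = ⊤ :=
  (Ideal.eq_top_iff_one _).mpr (Ideal.subset_span ⟨o, gPoly_zero_of_mem ho hJ⟩)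

/-- The generators for `{o}` include `1`, so `f_{ {o} }`, a factor of `f_J`, already lies in the
coinvariant ideal. -/
theorem colonIdeal_eq_top [CharZero K] {o : Fin n} (ho : (o : ℕ) = 0) (hJ : o ∈ J) :
    colonIdeal K J = ⊤ := by
  rw [Ideal.eq_top_iff_one, mem_colonIdeal, mul_one, ← Finset.insert_erase hJ,
    fPoly_insert (Finset.notMem_erase _ _),
    ← isWeaklyRegular_and_span_gPoly_empty.2]
  refine Ideal.mul_mem_right _ _ ?_
  have := prod_linearFactor_mul_mem (K := K) (J := ∅) (m := o) (y := 1) (by simp)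
    (by rw [span_gPoly_eq_top ho (by simp)]; trivial)
  rwa [mul_one] at this

theorem isRegular_gPoly [CharZero K] {o : Fin n} (ho : (o : ℕ) = 0) (hJ : o ∉ J) :
    IsRegular (MvPolynomial (Fin n) K) (List.ofFn (gPoly K J)) := by
  refine ⟨(isWeaklyRegular_and_colonIdeal ho hJ).1, fun htop => ?_⟩
  have h1 : (1 : MvPolynomial (Fin n) K) ∈ Ideal.ofList (List.ofFn (gPoly K J)) := by
    have : (1 : MvPolynomial (Fin n) K) ∈ (⊤ : Submodule (MvPolynomial (Fin n) K) _) := trivial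
    rw [htop] at this
    simpa using this
  have hle : Ideal.ofList (List.ofFn (gPoly K J)) ≤
      RingHom.ker (constantCoeff : MvPolynomial (Fin n) K →+* K) := by
    refine Ideal.span_le.mpr fun p hp => ?_
    obtain ⟨i, rfl⟩ := List.mem_ofFn.mp hp
    exact (posHomogeneous_gPoly ho hJ i).constantCoeff
  have := hle h1
  rw [RingHom.mem_ker, map_one] at this
  exact one_ne_zero this

end Colon

/-! ### Linear forms as prime polynomials -/

section LinearForms

variable {K : Type*} [Field K] {n : ℕ}

theorem eval_formPoly (α : Module.Dual K (Fin n → K)) (v : Fin n → K) :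
    eval v (formPoly α) = α v := by
  rw [formPoly, map_sum]
  conv_rhs => rw [← Finset.univ_sum_single v, map_sum]
  refine Finset.sum_congr rfl fun i _ => ?_
  have : Pi.single i (v i) = v i • (Pi.single i 1 : Fin n → K) := by
    rw [← Pi.single_smul, smul_eq_mul, mul_one]
  rw [this, map_smul]
  simp [mul_comm]

theorem formPoly_smul (c : K) (α : Module.Dual K (Fin n → K)) :
    formPoly (c • α) = C c * formPoly α := by
  simp [formPoly, Finset.mul_sum, mul_assoc]

theorem prime_formPoly {α : Module.Dual K (Fin n → K)} (hα : α ≠ 0) : Prime (formPoly α) := by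
  have hi : ∃ i, α (Pi.single i 1) ≠ 0 := by
    by_contra! h
    refine hα (LinearMap.ext fun v => ?_)
    rw [← eval_formPoly, formPoly]
    simp [h]
  obtain ⟨i, hi⟩ := hi
  let c : Fin n →₀ K := Finsupp.equivFunOnFinite.symm fun i => α (Pi.single i 1)
  have h : formPoly α = sumSMulX c := by
    rw [sumSMulX, Finsupp.linearCombination_apply, Finsupp.sum_fintype _ _ (by simp), formPoly]
    refine Finset.sum_congr rfl fun i _ => ?_
    rw [smul_eq_C_mul]
    rfl
  rw [h]
  refine (irreducible_sumSMulX c ⟨i, Finsupp.mem_support_iff.mpr hi⟩ fun r hr => ?_).prime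
  exact isUnit_iff_ne_zero.mpr fun h0 => hi (by simpa [h0, c] using hr i)

theorem ker_le_of_formPoly_dvd {α β : Module.Dual K (Fin n → K)}
    (h : formPoly α ∣ formPoly β) : LinearMap.ker α ≤ LinearMap.ker β := by
  intro v hv
  rw [LinearMap.mem_ker] at hv ⊢
  have := map_dvd (eval v) h
  rwa [eval_formPoly, eval_formPoly, hv, zero_dvd_iff] at this

theorem exists_eq_smul_of_ker_eq {α β : Module.Dual K (Fin n → K)} (hβ : β ≠ 0) (hα : α ≠ 0)
    (h : LinearMap.ker α = LinearMap.ker β) : ∃ c : K, c ≠ 0 ∧ α = c • β := by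
  obtain ⟨v, hv⟩ : ∃ v, β v ≠ 0 := by
    by_contra! h
    exact hβ (LinearMap.ext h)
  have key : α = (α v / β v) • β := by
    refine LinearMap.ext fun w => ?_
    have : w - (β w / β v) • v ∈ LinearMap.ker α := by
      rw [h, LinearMap.mem_ker, map_sub, map_smul, smul_eq_mul, div_mul_cancel₀ _ hv, sub_self]
    rw [LinearMap.mem_ker, map_sub, map_smul, sub_eq_zero] at this
    rw [this, LinearMap.smul_apply, smul_eq_mul, smul_eq_mul]
    ring
  exact ⟨_, fun h0 => hα (by rw [key, h0, zero_smul]), key⟩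

theorem formPoly_proj (j : Fin n) :
    formPoly (LinearMap.proj j : (Fin n → K) →ₗ[K] K) = X j := by
  simp [formPoly, Pi.single_apply]

theorem formPoly_proj_sub_proj (j i : Fin n) :
    formPoly ((LinearMap.proj j : (Fin n → K) →ₗ[K] K) - LinearMap.proj i) = X j - X i := by
  simp [formPoly, Pi.single_apply, sub_mul, Finset.sum_sub_distrib]

theorem proj_ne_zero (j : Fin n) : (LinearMap.proj j : (Fin n → K) →ₗ[K] K) ≠ 0 := fun h => by
  have := LinearMap.congr_fun h (Pi.single j 1)
  simp at this

theorem proj_sub_proj_ne_zero {j i : Fin n} (h : j ≠ i) :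
    (LinearMap.proj j : (Fin n → K) →ₗ[K] K) - LinearMap.proj i ≠ 0 := fun h0 => by
  have := LinearMap.congr_fun h0 (Pi.single j 1)
  simp [Pi.single_eq_of_ne h.symm] at this

theorem prime_X_sub_X {j i : Fin n} (h : j ≠ i) :
    Prime (X j - X i : MvPolynomial (Fin n) K) := by
  rw [← formPoly_proj_sub_proj]
  exact prime_formPoly (proj_sub_proj_ne_zero h)

theorem not_dvd_of_eval {p q : MvPolynomial (Fin n) K} (v : Fin n → K) (hp : eval v p = 0)
    (hq : eval v q ≠ 0) : ¬ p ∣ q := fun h => hq (by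
  have := map_dvd (eval v) h
  rwa [hp, zero_dvd_iff] at this)

end LinearForms

/-! ### Generators of the derivation module -/

section DerivationModule

/-- A derivation is logarithmic along a product of pairwise non-associated primes exactly when
it is logarithmic along each of them. -/
theorem prod_dvd_derivation_iff {k R ι : Type*} [CommRing k] [CommRing R] [IsDomain R]
    [Algebra k R] (D : Derivation k R R) (s : Finset ι) (p : ι → R) (hp : ∀ i ∈ s, Prime (p i))
    (hne : ∀ i ∈ s, ∀ j ∈ s, p i ∣ p j → i = j) :
    ∏ i ∈ s, p i ∣ D (∏ i ∈ s, p i) ↔ ∀ i ∈ s, p i ∣ D (p i) := by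
  classical
  constructor
  · intro h i hi
    rw [← Finset.mul_prod_erase s p hi, Derivation.leibniz, smul_eq_mul, smul_eq_mul] at h
    -- In the Leibniz expansion `p i` divides the term with `D` on the other factors, hence also the
    -- term containing `D (p i)`.
    have h1 := (dvd_add_right (Dvd.intro _ rfl)).mp ((Dvd.intro _ rfl).trans h)
    refine ((hp i hi).dvd_or_dvd h1).resolve_left fun h2 => ?_
    obtain ⟨j, hj, hij⟩ := (hp i hi).exists_mem_finset_dvd h2
    exact (Finset.mem_erase.mp hj).1 (hne i hi j (Finset.mem_erase.mp hj).2 hij).symm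
  · clear hp hne
    intro h
    induction s using Finset.induction_on with
    | empty => simp
    | insert a s ha ih =>
      rw [Finset.prod_insert ha, Derivation.leibniz, smul_eq_mul, smul_eq_mul]
      refine dvd_add (mul_dvd_mul_left _ (ih fun i hi => h i (Finset.mem_insert_of_mem hi))) ?_
      rw [mul_comm]
      exact mul_dvd_mul_left _ (h a (Finset.mem_insert_self _ _))

variable {K : Type*} [Field K] {n : ℕ}

theorem formOf_ne_zero {H : Submodule K (Fin n → K)}
    (hH : Module.finrank K ((Fin n → K) ⧸ H) = 1) : formOf H ≠ 0 := by
  intro h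
  have h1 := ker_formOf H hH
  rw [h, LinearMap.ker_zero] at h1
  rw [← h1, Module.finrank_zero_of_subsingleton] at hH
  exact zero_ne_one hH

/-- Divisibility between two of the forms gives inclusion of their kernels, hence equality by
dimension; so distinct hyperplanes give non-associated primes. -/
theorem HyperplaneArrangement.mem_der_iff (A : HyperplaneArrangement K n)
    (θ : Derivation K (MvPolynomial (Fin n) K) (MvPolynomial (Fin n) K)) :
    θ ∈ A.der ↔ ∀ H ∈ A.hyperplanes, formPoly (formOf H) ∣ θ (formPoly (formOf H)) := by
  change A.definingPoly ∣ θ A.definingPoly ↔ _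
  unfold HyperplaneArrangement.definingPoly
  rw [prod_dvd_derivation_iff]
  · simp
  · intro H hH
    exact prime_formPoly (formOf_ne_zero (A.codim_one H (by simpa using hH)))
  · intro H hH H' hH' hdvd
    have h1 := A.codim_one H (by simpa using hH)
    have h2 := A.codim_one H' (by simpa using hH')
    have hle := ker_le_of_formPoly_dvd hdvd
    rw [ker_formOf H h1, ker_formOf H' h2] at hle
    refine Submodule.eq_of_le_of_finrank_eq hle ?_
    have h3 := Submodule.finrank_quotient_add_finrank H
    have h4 := Submodule.finrank_quotient_add_finrank H'
    omega

/-- The form chosen by `formOf` is a nonzero scalar multiple of `α`, and derivations are `K`-linear.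
-/
theorem formPoly_formOf_dvd_iff {α : Module.Dual K (Fin n → K)} (hα : α ≠ 0)
    (θ : Derivation K (MvPolynomial (Fin n) K) (MvPolynomial (Fin n) K)) :
    formPoly (formOf (LinearMap.ker α)) ∣ θ (formPoly (formOf (LinearMap.ker α))) ↔
      formPoly α ∣ θ (formPoly α) := by
  have h1 := finrank_quotient_ker α hα
  obtain ⟨c, hc, h⟩ := exists_eq_smul_of_ker_eq hα (formOf_ne_zero h1) (ker_formOf _ h1)
  have hC : (C c : MvPolynomial (Fin n) K) ≠ 0 := by simpa using hc
  rw [h, formPoly_smul, ← smul_eq_C_mul, Derivation.map_smul, smul_eq_C_mul, smul_eq_C_mul,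
    mul_dvd_mul_iff_left hC]

variable {J : Finset (Fin n)}

theorem mem_der_arrangementJ_iff
    (θ : Derivation K (MvPolynomial (Fin n) K) (MvPolynomial (Fin n) K)) :
    θ ∈ (arrangementJ K J).der ↔ ∀ j ∉ J,
      (∀ i, j < i → X j - X i ∣ θ (X j - X i)) ∧ X j ∣ θ (X j) := by
  have h1 : ∀ j i : Fin n, j < i → (formPoly (formOf (diagHyperplane K j i)) ∣
      θ (formPoly (formOf (diagHyperplane K j i))) ↔ X j - X i ∣ θ (X j - X i)) := by
    intro j i hji
    rw [diagHyperplane, formPoly_formOf_dvd_iff (proj_sub_proj_ne_zero hji.ne),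
      formPoly_proj_sub_proj]
  have h2 : ∀ j : Fin n, (formPoly (formOf (coordHyperplane K j)) ∣
      θ (formPoly (formOf (coordHyperplane K j))) ↔ X j ∣ θ (X j)) := by
    intro j
    rw [coordHyperplane, formPoly_formOf_dvd_iff (proj_ne_zero j), formPoly_proj]
  rw [HyperplaneArrangement.mem_der_iff]
  constructor
  · intro h j hj
    exact ⟨fun i hji => (h1 j i hji).mp (h _ (Or.inl ⟨j, i, hj, hji, rfl⟩)),
      (h2 j).mp (h _ (Or.inr ⟨j, hj, rfl⟩))⟩
  · rintro h H (⟨j, i, hj, hji, rfl⟩ | ⟨j, hj, rfl⟩)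
    exacts [(h1 j i hji).mpr ((h j hj).1 i hji), (h2 j).mpr (h j hj).2]

theorem rho_apply_X_of_notMem {i : Fin n} (hi : i ∉ J) (k : Fin n) :
    rho K J i (X k) = if i ≤ k then
      (∏ j ∈ Finset.univ.filter (fun j => j ∉ J ∧ j < i), (X j - X k)) * X k else 0 := by
  rw [rho, if_pos hi, ← Derivation.coeFnAddMonoidHom_apply, map_sum, Finset.sum_apply]
  simp [pderiv_X, Pi.single_apply, Finset.sum_ite_eq]

theorem rho_apply_X_of_mem {i : Fin n} (hi : i ∈ J) (k : Fin n) :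
    rho K J i (X k) = if k = i then
      ∏ j ∈ Finset.univ.filter (fun j => j ∉ J ∧ j < i), (X j - X i) else 0 := by
  rw [rho, if_neg (not_not.mpr hi)]
  simp [pderiv_X, Pi.single_apply]

theorem rho_apply_X_of_lt {i k : Fin n} (h : k < i) : rho K J i (X k) = 0 := by
  by_cases hi : i ∈ J
  · rw [rho_apply_X_of_mem hi, if_neg h.ne]
  · rw [rho_apply_X_of_notMem hi, if_neg (not_le.mpr h)]

theorem rho_apply_X_self (i : Fin n) : rho K J i (X i) =
    (∏ j ∈ Finset.univ.filter (fun j => j ∉ J ∧ j < i), (X j - X i)) *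
      if i ∈ J then 1 else X i := by
  by_cases hi : i ∈ J
  · rw [rho_apply_X_of_mem hi, if_pos rfl, if_pos hi, mul_one]
  · rw [rho_apply_X_of_notMem hi, if_pos le_rfl, if_neg hi]

theorem rho_mem_der (i : Fin n) : rho K J i ∈ (arrangementJ K J).der := by
  rw [mem_der_arrangementJ_iff]
  by_cases hi : i ∈ J
  · intro j hj
    have hji : j ≠ i := fun h => hj (h ▸ hi)
    have h0 : rho K J i (X j) = 0 := by rw [rho_apply_X_of_mem hi, if_neg hji]
    refine ⟨fun k hjk => ?_, by rw [h0]; exact dvd_zero _⟩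
    rw [map_sub, h0, rho_apply_X_of_mem hi, zero_sub, dvd_neg]
    split_ifs with hk
    · subst hk
      exact Finset.dvd_prod_of_mem (fun j => (X j - X k : MvPolynomial (Fin n) K))
        (by simpa using ⟨hj, hjk⟩)
    · exact dvd_zero _
  · intro j hj
    constructor
    · intro k hjk
      rw [map_sub]
      rcases lt_or_ge j i with hji | hij
      · rw [rho_apply_X_of_lt hji, zero_sub, dvd_neg, rho_apply_X_of_notMem hi]
        split_ifs
        · exact (Finset.dvd_prod_of_mem (fun j => (X j - X k : MvPolynomial (Fin n) K))
            (by simpa using ⟨hj, hji⟩)).mul_right _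
        · exact dvd_zero _
      · rw [rho_apply_X_of_notMem hi, rho_apply_X_of_notMem hi, if_pos hij,
          if_pos (hij.trans hjk.le)]
        -- Both values come from one polynomial `q` evaluated at `x_j` and `x_k`, and `a - b`
        -- divides `q(a) - q(b)`.
        let q : Polynomial (MvPolynomial (Fin n) K) :=
          (∏ l ∈ Finset.univ.filter (fun l => l ∉ J ∧ l < i),
            (Polynomial.C (X l) - Polynomial.X)) * Polynomial.X
        have hq : ∀ a : MvPolynomial (Fin n) K, q.eval a =
            (∏ l ∈ Finset.univ.filter (fun l => l ∉ J ∧ l < i), (X l - a)) * a := by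
          intro a
          simp [q, Polynomial.eval_prod]
        rw [← hq, ← hq]
        exact Polynomial.sub_dvd_eval_sub _ _ q
    · rw [rho_apply_X_of_notMem hi]
      split_ifs
      · exact Dvd.intro_left _ rfl
      · exact dvd_zero _

/-- For `j ∉ J` with `j < i`, vanishing at `x_j` turns the condition along `x_j = x_i` into `x_j -
x_i ∣ θ(x_i)`. These factors, and `x_i` when `i ∉ J`, are pairwise coprime. -/
theorem rho_self_dvd {θ : Derivation K (MvPolynomial (Fin n) K) (MvPolynomial (Fin n) K)}
    (hθ : θ ∈ (arrangementJ K J).der) {i : Fin n} (h0 : ∀ k < i, θ (X k) = 0) :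
    rho K J i (X i) ∣ θ (X i) := by
  rw [mem_der_arrangementJ_iff] at hθ
  rw [rho_apply_X_self]
  refine IsRelPrime.mul_dvd ?_ (Finset.prod_dvd_of_isRelPrime ?_ fun j hj => ?_) ?_
  · refine IsRelPrime.prod_left fun j hj => ?_
    have hji : j < i := (Finset.mem_filter.mp hj).2.2
    split_ifs
    · exact isRelPrime_one_right
    · refine (prime_X_sub_X hji.ne).irreducible.isRelPrime_iff_not_dvd.mpr ?_
      exact not_dvd_of_eval (fun _ => 1) (by simp) (by simp)
  · intro j hj j' hj' hne
    have hji : j < i := (Finset.mem_filter.mp hj).2.2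
    have hji' : j' < i := (Finset.mem_filter.mp hj').2.2
    refine (prime_X_sub_X hji.ne).irreducible.isRelPrime_iff_not_dvd.mpr ?_
    -- At the unit vector of `j'`, `x_j - x_i` vanishes and `x_{j'} - x_i` does not.
    exact not_dvd_of_eval (Pi.single j' 1) (by simp [hne, hji'.ne'])
      (by simp [hji'.ne'])
  · obtain ⟨hj1, hji⟩ := (Finset.mem_filter.mp hj).2
    have := (hθ j hj1).1 i hji
    rwa [map_sub, h0 j hji, zero_sub, dvd_neg] at this
  · split_ifs with hi
    · exact one_dvd _
    · exact (hθ i hi).2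

/-- The derivations `rho K J i` generate the derivation module of `arrangementJ K J`. -/
theorem der_arrangementJ_eq_span :
    (arrangementJ K J).der = Submodule.span (MvPolynomial (Fin n) K) (Set.range (rho K J)) := by
  have hle : Submodule.span (MvPolynomial (Fin n) K) (Set.range (rho K J)) ≤
      (arrangementJ K J).der := by
    rw [Submodule.span_le]
    rintro _ ⟨i, rfl⟩
    exact rho_mem_der i
  refine le_antisymm (fun θ hθ => ?_) hle
  have key : ∀ t ≤ n, ∃ η ∈ Submodule.span (MvPolynomial (Fin n) K) (Set.range (rho K J)),
      ∀ k : Fin n, (k : ℕ) < t → (θ - η) (X k) = 0 := by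
    intro t
    induction t with
    | zero => exact fun _ => ⟨0, Submodule.zero_mem _, fun k hk => absurd hk (Nat.not_lt_zero _)⟩
    | succ t ih =>
      intro ht
      obtain ⟨η, hη, h0⟩ := ih (by omega)
      let i : Fin n := ⟨t, ht⟩
      -- Subtracting `w • rho K J i` clears the value at `x_i` without disturbing the earlier zeros.
      obtain ⟨w, hw⟩ := rho_self_dvd (Submodule.sub_mem _ hθ (hle hη)) (i := i) h0
      refine ⟨η + w • rho K J i, Submodule.add_mem _ hη
        (Submodule.smul_mem _ _ (Submodule.subset_span ⟨i, rfl⟩)), fun k hk => ?_⟩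
      rw [← sub_sub, Derivation.sub_apply, Derivation.smul_apply, smul_eq_mul]
      rcases eq_or_ne k i with rfl | hki
      · rw [hw]
        ring
      · have hlt : k < i := by
          have : (k : ℕ) ≠ t := fun h => hki (Fin.ext h)
          exact Fin.lt_def.mpr (by change (k : ℕ) < t; omega)
        rw [h0 k hlt, rho_apply_X_of_lt hlt, mul_zero, sub_zero]
  obtain ⟨η, hη, h0⟩ := key n le_rfl
  have : θ - η = 0 := MvPolynomial.derivation_ext fun k => by simpa using h0 k k.isLt
  rwa [sub_eq_zero.mp this]

theorem gPoly_eq_iMap_rho (i : Fin n) : gPoly K J i = iMap K n (rho K J i) := by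
  unfold gPoly rho
  split_ifs
  · rw [map_smul, iMap_pderiv, smul_eq_mul, mul_one]
  · rw [map_sum]
    refine Finset.sum_congr rfl fun k _ => ?_
    rw [map_smul, iMap_pderiv, smul_eq_mul, mul_one]

theorem solomonTeraoIdeal_arrangementJ :
    (arrangementJ K J).solomonTeraoIdeal (iMap K n) =
      Ideal.span (Set.range (gPoly K J)) := by
  rw [HyperplaneArrangement.solomonTeraoIdeal, der_arrangementJ_eq_span, Submodule.map_span,
    ← Set.range_comp]
  have : gPoly K J = iMap K n ∘ rho K J := funext gPoly_eq_iMap_rho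
  rw [this]

end DerivationModule

end SolomonTerao

theorem mainTheorem4 {K : Type*} [Field K] [CharZero K] {n : ℕ} (hn : 0 < n)
    (J : Finset (Fin n)) :
    (SolomonTerao.arrangementJ K J).solomonTeraoIdeal (SolomonTerao.iMap K n) =
        SolomonTerao.colonIdeal K J ∧
      (∀ i, SolomonTerao.gPoly K J i = SolomonTerao.iMap K n (SolomonTerao.rho K J i)) ∧
      ((⟨0, hn⟩ : Fin n) ∈ J → SolomonTerao.colonIdeal K J = ⊤) ∧
      ((⟨0, hn⟩ : Fin n) ∉ J →
        RingTheory.Sequence.IsRegular (MvPolynomial (Fin n) K)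
            (List.ofFn (SolomonTerao.gPoly K J)) ∧
          SolomonTerao.colonIdeal K J = Ideal.span (Set.range (SolomonTerao.gPoly K J))) := by
  refine ⟨?_, SolomonTerao.gPoly_eq_iMap_rho, SolomonTerao.colonIdeal_eq_top rfl, fun h =>
    ⟨SolomonTerao.isRegular_gPoly rfl h, (SolomonTerao.isWeaklyRegular_and_colonIdeal rfl h).2⟩⟩
  rw [SolomonTerao.solomonTeraoIdeal_arrangementJ]
  by_cases h : (⟨0, hn⟩ : Fin n) ∈ J
  · rw [SolomonTerao.span_gPoly_eq_top rfl h, SolomonTerao.colonIdeal_eq_top rfl h]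
  · rw [(SolomonTerao.isWeaklyRegular_and_colonIdeal rfl h).2]
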